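/- Let $T$ be a fixed tree with $t \ge 2$ vertices. For a graph $G$ on $n$ vertices, a $T$-factor of $G$ is a collection of vertex-disjoint (not necessarily induced) subgraphs of $G$, each isomorphic to $T$, that together cover all vertices of $G$. Then there is a constant $C>0$, depending only on $T$, with the following property. Let $\epsilon=\epsilon(n)>0$ and $p=p(n)\in[0,1]$ satisfy $$\frac{\epsilon^4 n p}{\log^2 n}\to\infty$$ as $n\to\infty$ through the multiples of $t$. Then, with probability tending to $1$ as $n\to\infty$ through the multiples of $t$, the binomial random graph $G_{n,p}$ contains a collection of pairwise edge-disjoint $T$-factors that covers all but at most a $C\epsilon$-fraction of its edges. -/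

import Mathlib

open Filter Topology

/-- `IsGraphFactor H F` : the collection `F` of (not necessarily induced) subgraphs of `G` is an
`H`-factor of `G`, that is, its members are copies of `H`, they are pairwise vertex-disjoint, and
together they cover all vertices of `G`. -/
structure IsGraphFactor {W V : Type*} (H : SimpleGraph W) {G : SimpleGraph V}
    (F : Set G.Subgraph) : Prop where
  /-- every member is isomorphic to `H` -/
  isCopy : ∀ K ∈ F, Nonempty (H ≃g K.coe)
  /-- distinct members have no common vertex -/
  vertexDisjoint : F.PairwiseDisjoint SimpleGraph.Subgraph.verts
  /-- every vertex of `G` lies in some member -/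
  covers : ∀ v : V, ∃ K ∈ F, v ∈ K.verts

/-- The set of all edges of the members of a collection of subgraphs of `G`. -/
def edgesOfFactor {V : Type*} {G : SimpleGraph V} (F : Set G.Subgraph) : Set (Sym2 V) :=
  ⋃ K ∈ F, K.edgeSet

/-- All but at most a `δ`-fraction of the edges of `G` can be covered by a collection `𝓕` of
pairwise edge-disjoint `H`-factors of `G`. -/
def CoverableByFactors {W V : Type*} (H : SimpleGraph W) (δ : ℝ) (G : SimpleGraph V) : Prop :=
  ∃ 𝓕 : Set (Set G.Subgraph),
    (∀ F ∈ 𝓕, IsGraphFactor H F) ∧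
    𝓕.PairwiseDisjoint edgesOfFactor ∧
    ((G.edgeSet \ ⋃ F ∈ 𝓕, edgesOfFactor F).ncard : ℝ) ≤ δ * (G.edgeSet.ncard : ℝ)

/-- The filter "`n → ∞` through the multiples of `t`". -/
def multiplesAtTop (t : ℕ) : Filter ℕ :=
  atTop ⊓ 𝓟 {n : ℕ | t ∣ n}

/-! Split the vertices into `t` classes of size `m = n / t`. A perfect matching between the classes
`i` and `j` for every edge `ij` of `T` yields a `T`-factor: a tree has no cycles, so following the
matchings from class to class cuts out `m` disjoint copies of `T`
(`exists_isGraphFactor_of_matchings`). It therefore suffices to pack perfect matchings in bipartite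
graphs.

One partition misses the edges inside classes or between classes not joined in `T`, so about `t log
n / ε²` random partitions are used. By Chernoff every pair is crossing in at most `M` of them, where
`M` is barely above the mean (`exists_partitions`). Crossing pairs are then distributed at random,
each going to any given partition that it crosses with probability `1 / M` (`exists_assignment`).
The resulting disjoint bipartite graphs have density at least about `1 / M` on every rectangle `S ×
S'` with `|S| + |S'| > m`.

Passing to `G_{n,p}` multiplies these lower bounds by nearly `p` (`binomialRandom_no_factors_le`). A
bipartite graph with such bounds on rectangles has a regular spanning subgraph of almost full degree
`d` (`exists_regular_subset`), which splits into `d` perfect matchings. Counting the edges used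
against an upper bound for the number of edges of the graph gives the result. -/

open MeasureTheory ProbabilityTheory Finset

/-! ### Chernoff bounds for the number of independent events that occur. -/

section Chernoff

variable {Ω ι : Type*}

/-- The number of indices `i ∈ s` whose event `D i` contains `ω`. -/
noncomputable def hitCount (D : ι → Set Ω) (s : Finset ι) (ω : Ω) : ℕ :=
  open Classical in #{i ∈ s | ω ∈ D i}

lemma hitCount_eq_sum (D : ι → Set Ω) (s : Finset ι) (ω : Ω) :
    (hitCount D s ω : ℝ) = (∑ i ∈ s, (D i).indicator fun _ => (1 : ℝ)) ω := by
  classical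
  rw [hitCount, Finset.sum_apply, Finset.natCast_card_filter]
  simp [Set.indicator_apply]

variable [MeasurableSpace Ω] {μ : Measure Ω}

lemma iIndepSet_preimage {κ : Type*} {E : κ → Set Ω} (h : iIndepSet E μ) {f : ι → κ}
    (hf : Function.Injective f) : iIndepSet (fun i => E (f i)) μ := by
  exact iIndep.precomp hf h

variable [IsProbabilityMeasure μ]

lemma mgf_indicator_one {D : Set Ω} (hD : MeasurableSet D) (θ : ℝ) :
    mgf (D.indicator fun _ => (1 : ℝ)) μ θ = 1 + μ.real D * (Real.exp θ - 1) := by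
  have h : (fun ω => Real.exp (θ * D.indicator (fun _ => (1 : ℝ)) ω)) =
      fun ω => 1 + D.indicator (fun _ => Real.exp θ - 1) ω := by
    funext ω
    by_cases hω : ω ∈ D <;> simp [hω]
  rw [mgf, h, integral_add (integrable_const _) ((integrable_const _).indicator hD),
    integral_indicator_const _ hD]
  simp

lemma mgf_hitCount_le {D : ι → Set Ω} (hD : ∀ i, MeasurableSet (D i)) (hind : iIndepSet D μ)
    (s : Finset ι) {x : ℝ} (hx : ∀ i ∈ s, μ.real (D i) = x) (θ : ℝ) :
    mgf (fun ω => (hitCount D s ω : ℝ)) μ θ ≤ Real.exp (x * #s * (Real.exp θ - 1)) := by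
  have h : (fun ω => (hitCount D s ω : ℝ)) = ∑ i ∈ s, (D i).indicator fun _ => (1 : ℝ) := by
    funext ω; exact hitCount_eq_sum D s ω
  rw [h, hind.iIndepFun_indicator.mgf_sum (fun i => measurable_const.indicator (hD i))]
  calc ∏ i ∈ s, mgf ((D i).indicator fun _ => (1 : ℝ)) μ θ
      ≤ ∏ i ∈ s, Real.exp (x * (Real.exp θ - 1)) := by
        refine Finset.prod_le_prod (fun i _ => mgf_nonneg) fun i hi => ?_
        rw [mgf_indicator_one (hD i), hx i hi, add_comm]
        exact Real.add_one_le_exp _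
    _ = _ := by rw [Finset.prod_const, ← Real.exp_nat_mul]; ring_nf

lemma integrable_exp_hitCount {D : ι → Set Ω}
    (hD : ∀ i, MeasurableSet (D i)) (s : Finset ι) (θ : ℝ) :
    Integrable (fun ω => Real.exp (θ * (hitCount D s ω : ℝ))) μ := by
  have hm : Measurable fun ω => (hitCount D s ω : ℝ) := by
    have h : (fun ω => (hitCount D s ω : ℝ)) = ∑ i ∈ s, (D i).indicator fun _ => (1 : ℝ) := by
      funext ω; exact hitCount_eq_sum D s ω
    rw [h, Finset.sum_fn]
    exact Finset.measurable_sum s fun i _ => measurable_const.indicator (hD i)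
  refine Integrable.of_bound (C := Real.exp (|θ| * #s)) (hm.const_mul θ).exp.aestronglyMeasurable
    (ae_of_all _ fun ω => ?_)
  rw [Real.norm_eq_abs, Real.abs_exp, Real.exp_le_exp]
  refine mul_le_mul (le_abs_self θ) ?_ (by positivity) (abs_nonneg θ)
  classical exact_mod_cast Finset.card_filter_le _ _

/-- Multiplicative **Chernoff bound**, lower tail. -/
theorem measureReal_hitCount_lt_le {D : ι → Set Ω} (hD : ∀ i, MeasurableSet (D i))
    (hind : iIndepSet D μ) (s : Finset ι) {x a δ : ℝ} (hx : ∀ i ∈ s, μ.real (D i) = x)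
    (ha : a ≤ x * #s) (ha0 : 0 ≤ a) (hδ : 0 ≤ δ) (hδ1 : δ ≤ 1) :
    μ.real {ω | (hitCount D s ω : ℝ) < (1 - δ) * a} ≤ Real.exp (-(δ ^ 2 * a / 4)) := by
  -- With `θ = -δ/2` the bound `e^θ - 1 ≤ θ + θ²` gives the exponent `(δ/2)(1 - δ)a + a(-δ/2 + δ²/4)
  -- = -δ²a/4`.
  have hexp : Real.exp (-(δ / 2)) - 1 ≤ -(δ / 2) + (δ / 2) ^ 2 := by
    have := Real.abs_exp_sub_one_sub_id_le (x := -(δ / 2)) (by rw [abs_le]; constructor <;> linarith)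
    have := (abs_le.1 this).2
    linarith
  calc μ.real {ω | (hitCount D s ω : ℝ) < (1 - δ) * a}
      ≤ μ.real {ω | (hitCount D s ω : ℝ) ≤ (1 - δ) * a} :=
        measureReal_mono (Set.ofPred_subset_ofPred.2 fun ω h => le_of_lt h)
    _ ≤ Real.exp (-(-(δ / 2)) * ((1 - δ) * a)) * mgf (fun ω => (hitCount D s ω : ℝ)) μ (-(δ / 2)) :=
        measure_le_le_exp_mul_mgf _ (by linarith) (integrable_exp_hitCount hD s _)
    _ ≤ Real.exp (-(-(δ / 2)) * ((1 - δ) * a)) *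
          Real.exp (x * #s * (Real.exp (-(δ / 2)) - 1)) := by
        gcongr; exact mgf_hitCount_le hD hind s hx _
    _ ≤ _ := by
        rw [← Real.exp_add, Real.exp_le_exp]
        have h1 : x * #s * (Real.exp (-(δ / 2)) - 1) ≤ x * #s * (-(δ / 2) + (δ / 2) ^ 2) :=
          mul_le_mul_of_nonneg_left hexp (ha0.trans ha)
        have h2 : x * #s * (-(δ / 2) + (δ / 2) ^ 2) ≤ a * (-(δ / 2) + (δ / 2) ^ 2) :=
          mul_le_mul_of_nonpos_right ha (by nlinarith)
        linarith

/-- Multiplicative **Chernoff bound**, upper tail. -/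
theorem measureReal_lt_hitCount_le {D : ι → Set Ω} (hD : ∀ i, MeasurableSet (D i))
    (hind : iIndepSet D μ) (s : Finset ι) {x b δ : ℝ} (hx : ∀ i ∈ s, μ.real (D i) = x)
    (hb : x * #s ≤ b) (hδ : 0 ≤ δ) (hδ1 : δ ≤ 1) :
    μ.real {ω | (1 + δ) * b < (hitCount D s ω : ℝ)} ≤ Real.exp (-(δ ^ 2 * b / 4)) := by
  have hexp : Real.exp (δ / 2) - 1 ≤ δ / 2 + (δ / 2) ^ 2 := by
    have := Real.abs_exp_sub_one_sub_id_le (x := δ / 2) (by rw [abs_le]; constructor <;> linarith)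
    have := (abs_le.1 this).2
    linarith
  have hexp0 : 0 ≤ Real.exp (δ / 2) - 1 := by
    have := Real.add_one_le_exp (δ / 2)
    linarith
  -- The value `x` is known to be a probability only when `s` has an element.
  have hb0 : 0 ≤ x * #s := by
    rcases s.eq_empty_or_nonempty with rfl | ⟨i, hi⟩
    · simp
    · rw [← hx i hi]; positivity
  calc μ.real {ω | (1 + δ) * b < (hitCount D s ω : ℝ)}
      ≤ μ.real {ω | (1 + δ) * b ≤ (hitCount D s ω : ℝ)} :=
        measureReal_mono (Set.ofPred_subset_ofPred.2 fun ω h => le_of_lt h)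
    _ ≤ Real.exp (-(δ / 2) * ((1 + δ) * b)) * mgf (fun ω => (hitCount D s ω : ℝ)) μ (δ / 2) :=
        measure_ge_le_exp_mul_mgf _ (by linarith) (integrable_exp_hitCount hD s _)
    _ ≤ Real.exp (-(δ / 2) * ((1 + δ) * b)) * Real.exp (x * #s * (Real.exp (δ / 2) - 1)) := by
        gcongr; exact mgf_hitCount_le hD hind s hx _
    _ ≤ _ := by
        rw [← Real.exp_add, Real.exp_le_exp]
        have h1 : x * #s * (Real.exp (δ / 2) - 1) ≤ b * (Real.exp (δ / 2) - 1) :=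
          mul_le_mul_of_nonneg_right hb hexp0
        have h2 : b * (Real.exp (δ / 2) - 1) ≤ b * (δ / 2 + (δ / 2) ^ 2) :=
          mul_le_mul_of_nonneg_left hexp (hb0.trans hb)
        linarith

end Chernoff

/-! ### Random sparsification keeps the density of all large rectangles. -/

section Bipartite

variable {Ω : Type*} [MeasurableSpace Ω] {μ : Measure Ω} [IsProbabilityMeasure μ] {m : ℕ}

/-- The larger of `s`, `s'` is at least `m / 2`, and `m < s + s'` makes the other factor on the left
at most twice the smaller one. The point is that the Chernoff exponent, proportional to `s s'`,
dominates a linear quantity over which the union bound can be summed. -/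
lemma mul_card_add_le {m s s' : ℕ} (h : m < s + s') (hs : s ≤ m) (hs' : s' ≤ m) :
    (m * (s + (m - s')) ≤ 4 * (s * s')) ∨ (m * (s' + (m - s)) ≤ 4 * (s * s')) := by
  obtain ⟨a, rfl⟩ := Nat.exists_eq_add_of_le hs
  obtain ⟨b, hb⟩ := Nat.exists_eq_add_of_le hs'
  have h1 : s + a - s' = b := by omega
  have h2 : s + a - s = a := by omega
  rw [h1, h2]
  rcases le_total s s' with hle | hle
  · left
    have : s + a ≤ 2 * s' := by omega
    have hbs : s + b ≤ 2 * s := by omega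
    calc _ ≤ (2 * s') * (2 * s) := Nat.mul_le_mul this hbs
      _ = _ := by ring
  · right
    have : s + a ≤ 2 * s := by omega
    have hbs : s' + a ≤ 2 * s' := by omega
    calc _ ≤ (2 * s) * (2 * s') := Nat.mul_le_mul this hbs
      _ = _ := by ring

/-- Over all pairs of sets the sum factorises into `(1 + r)^(2m)`. The pair `(∅, univ)` contributes
`1` and is excluded by the strict inequality, so what remains is at most `e^(2mr) - 1`. -/
lemma sum_pow_card_compl_le {m : ℕ} {r : ℝ} (hr : 0 ≤ r) (hmr : 2 * m * r ≤ 1) :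
    ∑ P : Finset (Fin m) × Finset (Fin m) with m < #P.1 + #P.2, r ^ (#P.1 + (m - #P.2))
      ≤ 4 * m * r := by
  have hall : ∑ P : Finset (Fin m) × Finset (Fin m), r ^ (#P.1 + (m - #P.2)) = (r + 1) ^ (2 * m) := by
    rw [Fintype.sum_prod_type]
    simp_rw [pow_add, ← Finset.mul_sum, ← Finset.sum_mul]
    have h1 : ∑ S : Finset (Fin m), r ^ #S = (r + 1) ^ m := by
      simpa using Fintype.sum_pow_mul_eq_add_pow (Fin m) r 1
    have h2 : ∑ S : Finset (Fin m), r ^ (m - #S) = (r + 1) ^ m := by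
      have := Fintype.sum_pow_mul_eq_add_pow (Fin m) 1 r
      rw [add_comm]
      simpa using this
    rw [h1, h2]; ring
  have hle : ∑ P : Finset (Fin m) × Finset (Fin m) with m < #P.1 + #P.2, r ^ (#P.1 + (m - #P.2)) + 1
      ≤ (r + 1) ^ (2 * m) := by
    rw [← hall, ← Finset.sum_filter_add_sum_filter_not univ
      (fun P : Finset (Fin m) × Finset (Fin m) => m < #P.1 + #P.2)]
    gcongr
    refine le_trans (by simp) (Finset.single_le_sum (f := fun P : Finset (Fin m) × Finset (Fin m) =>
      r ^ (#P.1 + (m - #P.2))) (a := (∅, univ)) (fun _ _ => by positivity) (by simp))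
  have hexp : (r + 1) ^ (2 * m) ≤ 1 + 2 * (2 * m * r) := by
    have h1 : (r + 1) ^ (2 * m) ≤ Real.exp (2 * m * r) := by
      calc (r + 1) ^ (2 * m) ≤ Real.exp r ^ (2 * m) := by
            gcongr; exact Real.add_one_le_exp r
        _ = _ := by rw [← Real.exp_nat_mul]; push_cast; ring_nf
    have h0 : 0 ≤ 2 * m * r := by positivity
    have h2 := Real.abs_exp_sub_one_sub_id_le (x := 2 * m * r) (by rw [abs_le]; constructor <;> linarith)
    have := (abs_le.1 h2).2
    nlinarith
  linarith

/-- If `W` has at least `w |S| |S'|` elements in `S × S'` whenever `|S| + |S'| > m`, then a random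
subset of `W`, each element being retained with probability `x`, has at least `(1 - δ) x w |S| |S'|`
elements in all these rectangles, with high probability. -/
theorem measureReal_exists_rectangle_le [DecidableEq (Fin m × Fin m)] {D : Fin m × Fin m → Set Ω}
    (hD : ∀ z, MeasurableSet (D z))
    (hind : iIndepSet D μ) (W : Finset (Fin m × Fin m)) {x w δ : ℝ} (hx0 : 0 ≤ x) (hw0 : 0 ≤ w)
    (hx : ∀ z ∈ W, μ.real (D z) = x)
    (hW : ∀ S S' : Finset (Fin m), m < #S + #S' → w * (#S * #S') ≤ #(W ∩ S ×ˢ S'))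
    (hδ : 0 ≤ δ) (hδ1 : δ ≤ 1) (hr : 2 * m * Real.exp (-(δ ^ 2 * x * w * m / 16)) ≤ 1) :
    μ.real {ω | ∃ S S' : Finset (Fin m), m < #S + #S' ∧
      (hitCount D (W ∩ S ×ˢ S') ω : ℝ) < (1 - δ) * (x * w * (#S * #S'))} ≤
      8 * m * Real.exp (-(δ ^ 2 * x * w * m / 16)) := by
  set r := Real.exp (-(δ ^ 2 * x * w * m / 16)) with hrdef
  have hr0 : 0 ≤ r := (Real.exp_pos _).le
  have hsub : {ω | ∃ S S' : Finset (Fin m), m < #S + #S' ∧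
      (hitCount D (W ∩ S ×ˢ S') ω : ℝ) < (1 - δ) * (x * w * (#S * #S'))} ⊆
      ⋃ P ∈ ({P | m < #P.1 + #P.2} : Finset (Finset (Fin m) × Finset (Fin m))),
        {ω | (hitCount D (W ∩ P.1 ×ˢ P.2) ω : ℝ) < (1 - δ) * (x * w * (#P.1 * #P.2))} := by
    rintro ω ⟨S, S', h, hlt⟩
    simp only [Set.mem_iUnion]
    exact ⟨(S, S'), by simpa using h, hlt⟩
  -- The 16 is the 4 of the Chernoff bound times the 4 of `mul_card_add_le`; both powers appear
  -- because either of its alternatives may hold.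
  have hone : ∀ P ∈ ({P | m < #P.1 + #P.2} : Finset (Finset (Fin m) × Finset (Fin m))),
      μ.real {ω | (hitCount D (W ∩ P.1 ×ˢ P.2) ω : ℝ) < (1 - δ) * (x * w * (#P.1 * #P.2))} ≤
        r ^ (#P.1 + (m - #P.2)) + r ^ (#P.2 + (m - #P.1)) := by
    rintro ⟨S, S'⟩ hP
    simp only [Finset.mem_filter, Finset.mem_univ, true_and] at hP ⊢
    have hcard : ∀ S : Finset (Fin m), #S ≤ m := fun S => by
      simpa using Finset.card_le_univ S
    have hpow : ∀ k : ℕ, m * k ≤ 4 * (#S * #S') →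
        Real.exp (-(δ ^ 2 * (x * w * (#S * #S')) / 4)) ≤ r ^ k := by
      intro k hk
      rw [hrdef, ← Real.exp_nat_mul, Real.exp_le_exp]
      have hk' : (m : ℝ) * k ≤ 4 * (#S * #S') := by exact_mod_cast hk
      have := mul_le_mul_of_nonneg_left hk' (show 0 ≤ δ ^ 2 * x * w by positivity)
      linarith
    refine (measureReal_hitCount_lt_le hD hind (W ∩ S ×ˢ S') (x := x) (fun z hz => hx z ?_) ?_
      (by positivity) hδ hδ1).trans ?_
    · exact Finset.mem_of_mem_inter_left hz
    · rw [mul_assoc]; exact mul_le_mul_of_nonneg_left (hW S S' hP) hx0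
    · rcases mul_card_add_le hP (hcard S) (hcard S') with h | h
      · exact (hpow _ h).trans (le_add_of_nonneg_right (by positivity))
      · exact (hpow _ h).trans (le_add_of_nonneg_left (by positivity))
  calc _ ≤ _ := measureReal_mono hsub (measure_ne_top _ _)
    _ ≤ _ := measureReal_biUnion_finset_le _ _
    _ ≤ ∑ P : Finset (Fin m) × Finset (Fin m) with m < #P.1 + #P.2,
        (r ^ (#P.1 + (m - #P.2)) + r ^ (#P.2 + (m - #P.1))) := Finset.sum_le_sum hone
    _ ≤ 4 * m * r + 4 * m * r := by
        rw [Finset.sum_add_distrib]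
        refine add_le_add (sum_pow_card_compl_le hr0 hr) (le_trans (le_of_eq ?_)
          (sum_pow_card_compl_le hr0 hr))
        refine Finset.sum_equiv (Equiv.prodComm _ _) (fun P => ?_) (fun P _ => rfl)
        simp [add_comm]
    _ = _ := by ring

end Bipartite

/-! ### Regular subgraphs and matchings of bipartite graphs. -/

section RegularBipartite

variable {α β : Type*}

lemma card_filter_fst_mem [DecidableEq α] (R : Finset (α × β)) (X : Finset α) :
    #{z ∈ R | z.1 ∈ X} = ∑ x ∈ X, #{z ∈ R | z.1 = x} := by
  rw [Finset.card_eq_sum_card_fiberwise (f := Prod.fst) (t := X) (by intro z; simp)]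
  refine Finset.sum_congr rfl fun x hx => ?_
  rw [Finset.filter_filter]
  congr 1
  ext z
  simp only [Finset.mem_filter]
  grind

lemma card_filter_snd_mem [DecidableEq β] (R : Finset (α × β)) (Y : Finset β) :
    #{z ∈ R | z.2 ∈ Y} = ∑ y ∈ Y, #{z ∈ R | z.2 = y} := by
  rw [Finset.card_eq_sum_card_fiberwise (f := Prod.snd) (t := Y) (by intro z; simp)]
  refine Finset.sum_congr rfl fun x hx => ?_
  rw [Finset.filter_filter]
  congr 1
  ext z
  simp only [Finset.mem_filter]
  grind

variable [Fintype β] [DecidableEq α] [DecidableEq β]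

/-- The inequality behind Hall's condition in the proof of `exists_regular_subset`. -/
lemma card_add_sum_sub_le {R : Finset (α × β)} {d : ℕ}
    (hR : ∀ (S : Finset α) (S' : Finset β),
      d * (#S + #S') ≤ #{z ∈ R | z.1 ∈ S ∧ z.2 ∈ S'} + d * Fintype.card β)
    (hα : ∀ x, d ≤ #{z ∈ R | z.1 = x}) (hβ : ∀ y, d ≤ #{z ∈ R | z.2 = y})
    (P : Finset (α × β)) (Y : Finset β) :
    #P + ∑ y ∈ Y, (#{z ∈ R | z.2 = y} - d) ≤
      #(P ∪ {z ∈ R | z.2 ∈ Y}) + ∑ x ∈ P.image Prod.fst, (#{z ∈ R | z.1 = x} - d) := by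
  set X := P.image Prod.fst with hX
  have hY1 : ∑ y ∈ Y, (#{z ∈ R | z.2 = y} - d) + #Y * d = #{z ∈ R | z.2 ∈ Y} := by
    rw [card_filter_snd_mem, ← smul_eq_mul, ← Finset.sum_const, ← Finset.sum_add_distrib]
    exact Finset.sum_congr rfl fun y _ => Nat.sub_add_cancel (hβ y)
  have hX1 : ∑ x ∈ X, (#{z ∈ R | z.1 = x} - d) + #X * d = #{z ∈ R | z.1 ∈ X} := by
    rw [card_filter_fst_mem, ← smul_eq_mul, ← Finset.sum_const, ← Finset.sum_add_distrib]
    exact Finset.sum_congr rfl fun x _ => Nat.sub_add_cancel (hα x)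
  have hU : #P + #{z ∈ R | z.1 ∉ X ∧ z.2 ∈ Y} ≤ #(P ∪ {z ∈ R | z.2 ∈ Y}) := by
    rw [← Finset.card_union_of_disjoint]
    · refine Finset.card_le_card fun z => ?_
      simp only [Finset.mem_union, Finset.mem_filter]
      tauto
    · rw [Finset.disjoint_left]
      intro z hz hz'
      exact (Finset.mem_filter.1 hz').2.1 (Finset.mem_image_of_mem _ hz)
  have hsplitY : #{z ∈ R | z.2 ∈ Y} =
      #{z ∈ R | z.1 ∈ X ∧ z.2 ∈ Y} + #{z ∈ R | z.1 ∉ X ∧ z.2 ∈ Y} := by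
    rw [← Finset.card_filter_add_card_filter_not (s := {z ∈ R | z.2 ∈ Y}) (fun z => z.1 ∈ X),
      Finset.filter_filter, Finset.filter_filter]
    simp only [and_comm]
  have hsplitX : #{z ∈ R | z.1 ∈ X} =
      #{z ∈ R | z.1 ∈ X ∧ z.2 ∈ Y} + #{z ∈ R | z.1 ∈ X ∧ z.2 ∈ Yᶜ} := by
    rw [← Finset.card_filter_add_card_filter_not (s := {z ∈ R | z.1 ∈ X}) (fun z => z.2 ∈ Y),
      Finset.filter_filter, Finset.filter_filter]
    simp only [Finset.mem_compl]
  -- After cancelling the edges between `X` and `Y` and those between `Xᶜ` and `Y`, the claim is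
  -- `d(|X| - |Y|) ≤ e(X, Yᶜ)`, which is this instance.
  have h := hR X Yᶜ
  have hc : #Y + #Yᶜ = Fintype.card β := Finset.card_add_card_compl Y
  rw [← hc] at h
  nlinarith

variable [Fintype α]

/-- A bipartite graph with parts of the same size in which the number of edges between any two sets
`S` and `S'` is at least `d (|S| + |S'| - |β|)` has a `d`-regular spanning subgraph. -/
theorem exists_regular_subset (hcard : Fintype.card α = Fintype.card β) (R : Finset (α × β)) (d : ℕ)
    (hR : ∀ (S : Finset α) (S' : Finset β),
      d * (#S + #S') ≤ #{z ∈ R | z.1 ∈ S ∧ z.2 ∈ S'} + d * Fintype.card β) :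
    ∃ H ⊆ R, (∀ x, #{z ∈ H | z.1 = x} = d) ∧ ∀ y, #{z ∈ H | z.2 = y} = d := by
  have hα : ∀ x, d ≤ #{z ∈ R | z.1 = x} := fun x => by
    have := hR {x} univ
    simp only [Finset.card_singleton, Finset.mem_singleton, Finset.mem_univ, and_true,
      Finset.card_univ] at this
    linarith
  have hβ : ∀ y, d ≤ #{z ∈ R | z.2 = y} := fun y => by
    have := hR univ {y}
    simp only [Finset.card_singleton, Finset.mem_singleton, Finset.mem_univ, true_and,
      Finset.card_univ, hcard] at this
    linarith
  -- Auxiliary matching problem: the left side has the edges of `R` and `deg y - d` slots at each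
  -- `y`, the right side has the edges of `R` and `deg x - d` slots at each `x`. An edge may be
  -- matched to its own copy or to a slot at its first end; a slot at `y` may be matched to the copy
  -- of an edge ending at `y`.
  let t : R ⊕ (Σ y : β, Fin (#{z ∈ R | z.2 = y} - d)) →
      Finset (R ⊕ (Σ x : α, Fin (#{z ∈ R | z.1 = x} - d))) := fun l => match l with
    | .inl e => ({e} : Finset R).disjSum (univ.filter fun c => c.1 = e.1.1)
    | .inr c => (univ.filter fun e : R => e.1.2 = c.1).disjSum ∅
  have ht1 : ∀ e e', Sum.inl e' ∈ t (.inl e) ↔ e' = e := fun e e' => by simp [t]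
  have ht2 : ∀ e c, Sum.inr c ∈ t (.inl e) ↔ c.1 = e.1.1 := fun e c => by simp [t]
  have ht3 : ∀ c e, Sum.inl e ∈ t (.inr c) ↔ e.1.2 = c.1 := fun e c => by simp [t]
  have ht4 : ∀ c c', Sum.inr c' ∉ t (.inr c) := fun c c' => by simp [t]
  have hall : ∀ s : Finset (R ⊕ (Σ y : β, Fin (#{z ∈ R | z.2 = y} - d))),
      #s ≤ #(s.biUnion t) := by
    intro s
    rw [← Finset.card_toLeft_add_card_toRight, ← Finset.card_toLeft_add_card_toRight (u := s.biUnion t)]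
    set P : Finset (α × β) := s.toLeft.map (Function.Embedding.subtype _) with hP
    set Y : Finset β := s.toRight.image Sigma.fst with hY
    have h1 : #s.toLeft = #P := by simp [hP]
    have h2 : #s.toRight ≤ ∑ y ∈ Y, (#{z ∈ R | z.2 = y} - d) := by
      have hsub : s.toRight ⊆ Y.sigma fun y => univ := by
        intro c hc
        simp only [Finset.mem_sigma, Finset.mem_univ, and_true]
        exact Finset.mem_image_of_mem _ hc
      refine (Finset.card_le_card hsub).trans ?_
      rw [Finset.card_sigma]; simp
    have h3 : #(P ∪ {z ∈ R | z.2 ∈ Y}) ≤ #(s.biUnion t).toLeft := by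
      rw [← Finset.card_map (Function.Embedding.subtype (· ∈ R)) (s := (s.biUnion t).toLeft)]
      refine Finset.card_le_card fun z hz => ?_
      simp only [Finset.mem_map, Finset.mem_toLeft, Finset.mem_biUnion,
        Function.Embedding.subtype_apply]
      rcases Finset.mem_union.1 hz with hz | hz
      · obtain ⟨e, he, rfl⟩ := Finset.mem_map.1 hz
        exact ⟨e, ⟨.inl e, Finset.mem_toLeft.1 he, (ht1 e e).2 rfl⟩, rfl⟩
      · obtain ⟨hzR, hzY⟩ := Finset.mem_filter.1 hz
        obtain ⟨c, hc, hcz⟩ := Finset.mem_image.1 hzY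
        exact ⟨⟨z, hzR⟩, ⟨.inr c, Finset.mem_toRight.1 hc, (ht3 _ _).2 hcz.symm⟩, rfl⟩
    have h4 : ∑ x ∈ P.image Prod.fst, (#{z ∈ R | z.1 = x} - d) ≤ #(s.biUnion t).toRight := by
      have hsub : ((P.image Prod.fst).sigma fun x => univ) ⊆ (s.biUnion t).toRight := by
        intro c hc
        simp only [Finset.mem_sigma, Finset.mem_univ, and_true] at hc
        obtain ⟨z, hz, hzc⟩ := Finset.mem_image.1 hc
        obtain ⟨e, he, rfl⟩ := Finset.mem_map.1 hz
        exact Finset.mem_toRight.2 (Finset.mem_biUnion.2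
          ⟨.inl e, Finset.mem_toLeft.1 he, (ht2 _ _).2 hzc.symm⟩)
      refine le_trans (le_of_eq ?_) (Finset.card_le_card hsub)
      rw [Finset.card_sigma]; simp
    have := card_add_sum_sub_le hR hα hβ P Y
    omega
  obtain ⟨f, hfinj, hft⟩ := (Finset.all_card_le_biUnion_card_iff_exists_injective t).1 hall
  have hsumα : ∑ x, #{z ∈ R | z.1 = x} = #R := by
    have := card_filter_fst_mem R univ
    simpa using this.symm
  have hsumβ : ∑ y, #{z ∈ R | z.2 = y} = #R := by
    have := card_filter_snd_mem R univ
    simpa using this.symm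
  have hfbij : Function.Bijective f := by
    rw [Fintype.bijective_iff_injective_and_card]
    refine ⟨hfinj, ?_⟩
    simp only [Fintype.card_sum, Fintype.card_sigma, Fintype.card_fin]
    rw [Finset.sum_tsub_distrib _ fun x _ => hα x, Finset.sum_tsub_distrib _ fun x _ => hβ x,
      hsumα, hsumβ]
    simp [hcard]
  -- The edges matched to themselves. At `x`, the edges outside `H` fill exactly the `deg x - d`
  -- slots; at `y`, their copies are taken exactly by the `deg y - d` slots. So `d` edges of `H`
  -- remain at each vertex.
  set H : Finset (α × β) := (univ.filter fun e : R => f (.inl e) = .inl e).map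
    (Function.Embedding.subtype _) with hH
  have hmemH : ∀ e : R, e.1 ∈ H ↔ f (.inl e) = .inl e := by
    intro e
    simp [hH]
  have hHR : H ⊆ R := by
    intro z hz
    obtain ⟨e, -, rfl⟩ := Finset.mem_map.1 hz
    exact e.2
  refine ⟨H, hHR, fun x => ?_, fun y => ?_⟩
  · have hsplit : #{z ∈ R | z.1 = x} = #{z ∈ H | z.1 = x} + #{z ∈ R | z.1 = x ∧ z ∉ H} := by
      rw [← Finset.card_filter_add_card_filter_not (s := {z ∈ R | z.1 = x}) (fun z => z ∈ H),
        Finset.filter_filter, Finset.filter_filter]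
      congr 2
      ext z
      simp only [Finset.mem_filter]
      exact ⟨fun h => ⟨h.2.2, h.2.1⟩, fun h => ⟨hHR h.1, h.2, h.1⟩⟩
    have hrest : #{z ∈ R | z.1 = x ∧ z ∉ H} = #{z ∈ R | z.1 = x} - d := by
      have key : ∀ c : Fin (#{z ∈ R | z.1 = x} - d), ∃ e : R, f (.inl e) = .inr ⟨x, c⟩ := by
        intro c
        obtain ⟨l, hl⟩ := hfbij.2 (.inr ⟨x, c⟩)
        rcases l with e | c'
        · exact ⟨e, hl⟩
        · exact absurd (hl ▸ hft (.inr c')) (ht4 _ _)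
      choose g hg using key
      have : #{z ∈ R | z.1 = x ∧ z ∉ H} = #(univ : Finset (Fin (#{z ∈ R | z.1 = x} - d))) := by
        symm
        refine Finset.card_bij (fun c _ => (g c).1) (fun c _ => ?_) (fun c _ c' _ h => ?_) ?_
        · have h1 := hft (.inl (g c))
          rw [hg, ht2] at h1
          refine Finset.mem_filter.2 ⟨(g c).2, h1.symm, fun hmem => ?_⟩
          have h2 := (hmemH _).1 hmem
          rw [hg] at h2
          simp at h2
        · have h1 : g c = g c' := Subtype.ext h
          have h2 := hg c
          rw [h1, hg c'] at h2
          simpa using h2.symm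
        · intro z hz
          obtain ⟨hzR, hzx, hzH⟩ := Finset.mem_filter.1 hz
          rcases hfe : f (.inl ⟨z, hzR⟩) with e' | c
          · have h1 := hft (.inl ⟨z, hzR⟩)
            rw [hfe, ht1] at h1
            rw [h1] at hfe
            exact absurd ((hmemH ⟨z, hzR⟩).2 hfe) hzH
          · obtain ⟨x', c⟩ := c
            have h1 := hft (.inl ⟨z, hzR⟩)
            rw [hfe, ht2] at h1
            obtain rfl : x' = x := h1.trans hzx
            refine ⟨c, Finset.mem_univ _, ?_⟩
            have h2 : g c = ⟨z, hzR⟩ := Sum.inl_injective (hfinj ((hg c).trans hfe.symm))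
            rw [h2]
      rw [this]; simp
    have := hα x
    omega
  · have hsplit : #{z ∈ R | z.2 = y} = #{z ∈ H | z.2 = y} + #{z ∈ R | z.2 = y ∧ z ∉ H} := by
      rw [← Finset.card_filter_add_card_filter_not (s := {z ∈ R | z.2 = y}) (fun z => z ∈ H),
        Finset.filter_filter, Finset.filter_filter]
      congr 2
      ext z
      simp only [Finset.mem_filter]
      exact ⟨fun h => ⟨h.2.2, h.2.1⟩, fun h => ⟨hHR h.1, h.2, h.1⟩⟩
    have hrest : #{z ∈ R | z.2 = y ∧ z ∉ H} = #{z ∈ R | z.2 = y} - d := by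
      have key : ∀ c : Fin (#{z ∈ R | z.2 = y} - d), ∃ e : R, f (.inr ⟨y, c⟩) = .inl e := by
        intro c
        rcases hfc : f (.inr ⟨y, c⟩) with e | c'
        · exact ⟨e, rfl⟩
        · exact absurd (hfc ▸ hft (.inr ⟨y, c⟩)) (ht4 _ _)
      choose g hg using key
      have : #{z ∈ R | z.2 = y ∧ z ∉ H} = #(univ : Finset (Fin (#{z ∈ R | z.2 = y} - d))) := by
        symm
        refine Finset.card_bij (fun c _ => (g c).1) (fun c _ => ?_) (fun c _ c' _ h => ?_) ?_
        · have h1 := hft (.inr ⟨y, c⟩)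
          rw [hg, ht3] at h1
          refine Finset.mem_filter.2 ⟨(g c).2, h1, fun hmem => ?_⟩
          have h2 := hfinj (((hmemH _).1 hmem).trans (hg c).symm)
          simp at h2
        · have h1 : g c = g c' := Subtype.ext h
          have h2 := hfinj ((hg c).trans ((congrArg Sum.inl h1).trans (hg c').symm))
          simpa using h2
        · intro z hz
          obtain ⟨hzR, hzy, hzH⟩ := Finset.mem_filter.1 hz
          obtain ⟨l, hl⟩ := hfbij.2 (.inl ⟨z, hzR⟩)
          rcases l with e' | ⟨y', c⟩
          · have h1 := hft (.inl e')
            rw [hl, ht1] at h1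
            rw [← h1] at hl
            exact absurd ((hmemH ⟨z, hzR⟩).2 hl) hzH
          · have h1 := hft (.inr ⟨y', c⟩)
            rw [hl, ht3] at h1
            obtain rfl : y' = y := h1.symm.trans hzy
            refine ⟨c, Finset.mem_univ _, ?_⟩
            have h2 : g c = ⟨z, hzR⟩ := Sum.inl_injective ((hg c).symm.trans hl)
            rw [h2]
      rw [this]; simp
    have := hβ y
    omega

/-- A `d`-regular bipartite graph decomposes into `d` perfect matchings. -/
theorem exists_equiv_family_of_regular (hcard : Fintype.card α = Fintype.card β) (d : ℕ)
    (H : Finset (α × β)) (h1 : ∀ x, #{z ∈ H | z.1 = x} = d) (h2 : ∀ y, #{z ∈ H | z.2 = y} = d) :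
    ∃ π : Fin d → α ≃ β, (∀ k x, (x, π k x) ∈ H) ∧
      ∀ k l, k ≠ l → ∀ x, π k x ≠ π l x := by
  induction d generalizing H with
  | zero => exact ⟨fun k => k.elim0, fun k => k.elim0, fun k => k.elim0⟩
  | succ d ih =>
    obtain ⟨f, hfinj, hf⟩ := (Finset.all_card_le_biUnion_card_iff_exists_injective
      (fun x : α => univ.filter fun y => (x, y) ∈ H)).1 (by
        intro S
        refine Nat.le_of_mul_le_mul_right (c := d + 1) ?_ (Nat.succ_pos d)
        have e1 : #{z ∈ H | z.1 ∈ S} = #S * (d + 1) := by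
          rw [card_filter_fst_mem, Finset.sum_congr rfl fun x _ => h1 x]; simp
        have e2 : ∀ Y : Finset β, #{z ∈ H | z.2 ∈ Y} = #Y * (d + 1) := fun Y => by
          rw [card_filter_snd_mem, Finset.sum_congr rfl fun x _ => h2 x]; simp
        rw [← e1, ← e2]
        refine Finset.card_le_card fun z hz => ?_
        obtain ⟨hz, hzS⟩ := Finset.mem_filter.1 hz
        exact Finset.mem_filter.2 ⟨hz, Finset.mem_biUnion.2 ⟨z.1, hzS, by simpa using hz⟩⟩)
    have hfH : ∀ x, (x, f x) ∈ H := fun x => by simpa using hf x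
    let σ : α ≃ β := Equiv.ofBijective f
      ((Fintype.bijective_iff_injective_and_card f).2 ⟨hfinj, hcard⟩)
    have hσ : ∀ x, σ x = f x := fun x => rfl
    obtain ⟨π, hπ, hπd⟩ := ih {z ∈ H | z.2 ≠ f z.1} (fun x => by
        have : {z ∈ {z ∈ H | z.2 ≠ f z.1} | z.1 = x} = {z ∈ H | z.1 = x}.erase (x, f x) := by
          ext ⟨a, b⟩
          simp only [Finset.mem_filter, Finset.mem_erase, ne_eq, Prod.mk.injEq]
          grind
        rw [this, Finset.card_erase_of_mem (by simp [hfH]), h1]; rfl)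
      (fun y => by
        have : {z ∈ {z ∈ H | z.2 ≠ f z.1} | z.2 = y} =
            {z ∈ H | z.2 = y}.erase (σ.symm y, y) := by
          ext ⟨a, b⟩
          simp only [Finset.mem_filter, Finset.mem_erase, ne_eq, Prod.mk.injEq,
            Equiv.eq_symm_apply, hσ]
          grind
        have hmem : (σ.symm y, y) ∈ H := by
          have := hfH (σ.symm y)
          rwa [← hσ, Equiv.apply_symm_apply] at this
        rw [this, Finset.card_erase_of_mem (by simp [hmem]), h2]; rfl)
    refine ⟨Fin.cons σ π, fun k x => ?_, fun k l hkl x => ?_⟩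
    · refine Fin.cases ?_ (fun k => ?_) k
      · simpa [hσ] using hfH x
      · simpa using (Finset.mem_filter.1 (hπ k x)).1
    · have hne : ∀ k, π k x ≠ σ x := fun k => (Finset.mem_filter.1 (hπ k x)).2
      induction k using Fin.cases with
      | zero =>
        induction l using Fin.cases with
        | zero => exact absurd rfl hkl
        | succ l => simpa using (hne l).symm
      | succ k =>
        induction l using Fin.cases with
        | zero => simpa using hne k
        | succ l => simpa using hπd k l (fun h => hkl (h ▸ rfl)) x

/-- A bipartite graph satisfying the condition of `exists_regular_subset` contains `d` pairwise
edge-disjoint perfect matchings. -/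
theorem exists_equiv_family (hcard : Fintype.card α = Fintype.card β) (R : Finset (α × β)) (d : ℕ)
    (hR : ∀ (S : Finset α) (S' : Finset β),
      d * (#S + #S') ≤ #{z ∈ R | z.1 ∈ S ∧ z.2 ∈ S'} + d * Fintype.card β) :
    ∃ π : Fin d → α ≃ β, (∀ k x, (x, π k x) ∈ R) ∧
      ∀ k l, k ≠ l → ∀ x, π k x ≠ π l x := by
  obtain ⟨H, hHR, h1, h2⟩ := exists_regular_subset hcard R d hR
  obtain ⟨π, hπ, hd⟩ := exists_equiv_family_of_regular hcard d H h1 h2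
  exact ⟨π, fun k x => hHR (hπ k x), hd⟩

end RegularBipartite

/-! ### From perfect matchings to tree factors. -/

section TreeFactor

/-- Group elements prescribed on the darts of a tree, inverse to each other on opposite darts, are
the quotients of a function on the vertices. -/
theorem SimpleGraph.IsTree.exists_potential {W Γ : Type*} [Group Γ] {T : SimpleGraph W}
    (hT : T.IsTree) (g : W → W → Γ) (hg : ∀ i j, T.Adj i j → g j i = (g i j)⁻¹) :
    ∃ φ : W → Γ, ∀ i j, T.Adj i j → φ j = g i j * φ i := by
  obtain ⟨r⟩ := hT.connected.nonempty
  -- The potential of a vertex is the product of the `g` values along its path to the root.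
  let w : ∀ {u v : W}, T.Walk u v → Γ := fun {u v} p =>
    SimpleGraph.Walk.rec (motive := fun _ _ _ => Γ) 1 (fun {u v _} _ _ c => g v u * c) p
  have hcons : ∀ {u v x : W} (h : T.Adj u v) (p : T.Walk v x), w (.cons h p) = g v u * w p :=
    fun h p => rfl
  choose P hP hPu using fun v => hT.existsUnique_path v r
  have key : ∀ i j, T.Adj i j → j ∈ (P i).support → w (P j) = g i j * w (P i) := by
    intro i j hij hj
    generalize hp : P i = p at hj
    have hpath : p.IsPath := hp ▸ hP i
    have hsnd := hT.isAcyclic.eq_snd_of_adj_start hpath hij hj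
    cases p with
    | nil =>
      simp only [SimpleGraph.Walk.support_nil, List.mem_singleton] at hj
      exact absurd hj.symm hij.ne
    | cons h q =>
      simp only [SimpleGraph.Walk.snd_cons] at hsnd
      subst hsnd
      have hq : q = P j := hPu _ q hpath.of_cons
      rw [hcons hij q, hg i j hij, hq, mul_inv_cancel_left]
  refine ⟨fun v => w (P v), fun i j hij => ?_⟩
  -- Of two adjacent vertices, one lies on the path of the other to the root; uniqueness of paths
  -- makes the two paths differ by the edge `ij` alone.
  by_cases hj : j ∈ (P i).support
  · exact key i j hij hj
  · have hq : SimpleGraph.Walk.cons hij.symm (P i) = P j :=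
      hPu _ _ ((SimpleGraph.Walk.cons_isPath_iff _ _).2 ⟨hP i, hj⟩)
    change w (P j) = _
    rw [← hq, hcons hij.symm (P i)]

variable {t m : ℕ} {V : Type*} {T : SimpleGraph (Fin t)} {G : SimpleGraph V}

/-- If `e` identifies `V` with `t` classes of size `m`, then bijections `φ i` between the classes
such that all the pairs `e (i, φ i y)`, `e (j, φ j y)` with `ij` an edge of `T` are edges of `G`
yield a `T`-factor of `G` consisting of these edges. -/
theorem exists_isGraphFactor_of_perm (e : Fin t × Fin m ≃ V) (φ : Fin t → Equiv.Perm (Fin m))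
    (h : ∀ i j y, T.Adj i j → G.Adj (e (i, φ i y)) (e (j, φ j y))) :
    ∃ F : Set G.Subgraph, IsGraphFactor T F ∧
      edgesOfFactor F = {a | ∃ i j y, T.Adj i j ∧ a = s(e (i, φ i y), e (j, φ j y))} := by
  let c : Fin m → T.Copy G := fun y =>
    ⟨⟨fun i => e (i, φ i y), fun {i j} hij => h i j y hij⟩, fun i j hij => by
      simpa using congrArg Prod.fst (e.injective hij)⟩
  have hc : ∀ y i, (c y).toHom i = e (i, φ i y) := fun y i => rfl
  refine ⟨Set.range fun y => (c y).toSubgraph, ⟨?_, ?_, ?_⟩, ?_⟩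
  · rintro _ ⟨y, rfl⟩
    exact ⟨(c y).isoToSubgraph⟩
  · rintro _ ⟨y, rfl⟩ _ ⟨y', rfl⟩ hne
    refine Set.disjoint_left.2 fun v hv hv' => hne ?_
    simp only [SimpleGraph.Subgraph.map_verts, SimpleGraph.Subgraph.verts_top, Set.image_univ,
      Set.mem_range, hc] at hv hv'
    obtain ⟨i, rfl⟩ := hv
    obtain ⟨j, hj⟩ := hv'
    have h1 := e.injective hj
    simp only [Prod.mk.injEq] at h1
    obtain ⟨rfl, h2⟩ := h1
    rw [(φ j).injective h2]
  · intro v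
    refine ⟨_, ⟨(φ (e.symm v).1).symm (e.symm v).2, rfl⟩, ?_⟩
    simp only [SimpleGraph.Subgraph.map_verts, SimpleGraph.Subgraph.verts_top, Set.image_univ,
      Set.mem_range, hc]
    exact ⟨(e.symm v).1, by simp⟩
  · ext a
    induction a with
    | _ u v =>
    simp only [edgesOfFactor, Set.mem_range, Set.iUnion_exists, Set.iUnion_iUnion_eq',
      Set.mem_iUnion, SimpleGraph.Subgraph.mem_edgeSet, SimpleGraph.Subgraph.map_adj,
      Relation.map_apply, SimpleGraph.Subgraph.top_adj, hc, Set.mem_ofPred_eq]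
    constructor
    · rintro ⟨y, i, j, hij, rfl, rfl⟩
      exact ⟨i, j, y, hij, rfl⟩
    · rintro ⟨i, j, y, hij, huv⟩
      rcases Sym2.eq_iff.1 huv with ⟨rfl, rfl⟩ | ⟨rfl, rfl⟩
      · exact ⟨y, i, j, hij, rfl, rfl⟩
      · exact ⟨y, j, i, hij.symm, rfl, rfl⟩

/-- The edges `ij` of `T`, listed as pairs with `i < j`. -/
noncomputable def orderedEdges (T : SimpleGraph (Fin t)) : Finset (Fin t × Fin t) :=
  open Classical in {q | T.Adj q.1 q.2 ∧ q.1 < q.2}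

lemma mem_orderedEdges {q : Fin t × Fin t} :
    q ∈ orderedEdges T ↔ T.Adj q.1 q.2 ∧ q.1 < q.2 := by
  simp [orderedEdges]

lemma card_orderedEdges (hT : T.IsTree) : #(orderedEdges T) + 1 = t := by
  classical
  have h := hT.card_edgeFinset
  rw [Fintype.card_fin] at h
  refine Eq.trans ?_ h
  congr 1
  refine Finset.card_bij (fun q _ => s(q.1, q.2)) (fun q hq => ?_) (fun q hq q' hq' h => ?_) ?_
  · simpa using (mem_orderedEdges.1 hq).1
  · have h1 := (mem_orderedEdges.1 hq).2
    have h2 := (mem_orderedEdges.1 hq').2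
    rcases Sym2.eq_iff.1 h with ⟨h3, h4⟩ | ⟨h3, h4⟩
    · exact Prod.ext h3 h4
    · rw [h3, h4] at h1
      exact absurd h1 h2.asymm
  · intro a
    induction a with
    | _ i j =>
    intro ha
    have ha : T.Adj i j := by simpa using ha
    rcases lt_or_gt_of_ne ha.ne with hlt | hlt
    · exact ⟨(i, j), mem_orderedEdges.2 ⟨ha, hlt⟩, rfl⟩
    · exact ⟨(j, i), mem_orderedEdges.2 ⟨ha.symm, hlt⟩, Sym2.eq_swap⟩

/-- The order on the classes fixes the orientation of an unordered pair, so its coordinates can be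
read off. -/
lemma pair_eq_of_lt (e : Fin t × Fin m ≃ V) {i j i' j' : Fin t} {x y x' y' : Fin m} (hij : i < j)
    (hij' : i' < j') (h : s(e (i, x), e (j, y)) = s(e (i', x'), e (j', y'))) :
    i = i' ∧ j = j' ∧ x = x' ∧ y = y' := by
  rcases Sym2.eq_iff.1 h with ⟨h1, h2⟩ | ⟨h1, h2⟩
  · have h1 := e.injective h1
    have h2 := e.injective h2
    simp only [Prod.mk.injEq] at h1 h2
    exact ⟨h1.1, h2.1, h1.2, h2.2⟩
  · have h1 := e.injective h1
    have h2 := e.injective h2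
    simp only [Prod.mk.injEq] at h1 h2
    rw [h1.1, h2.1] at hij
    exact absurd hij hij'.asymm

/-- Perfect matchings between the classes of a partition of the vertex set, one for each edge of a
tree, combine to a factor. -/
theorem exists_isGraphFactor_of_matchings (hT : T.IsTree) (e : Fin t × Fin m ≃ V)
    (π : Fin t × Fin t → Equiv.Perm (Fin m))
    (hπ : ∀ q ∈ orderedEdges T, ∀ x, s(e (q.1, x), e (q.2, π q x)) ∈ G.edgeSet) :
    ∃ F : Set G.Subgraph, IsGraphFactor T F ∧
      edgesOfFactor F = {a | ∃ q ∈ orderedEdges T, ∃ x, a = s(e (q.1, x), e (q.2, π q x))} := by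
  -- Crossing the edge `ij` applies its matching or the inverse. In the potential `φ`, the copy of
  -- `T` labelled `y` meets class `i` in `φ i y`.
  obtain ⟨φ, hφ⟩ := hT.exists_potential (Γ := Equiv.Perm (Fin m))
    (fun i j => if i < j then π (i, j) else (π (j, i))⁻¹) (fun i j hij => by
      rcases lt_or_gt_of_ne hij.ne with hlt | hlt
      · simp [hlt, hlt.asymm]
      · simp [hlt, hlt.asymm])
  have hlt : ∀ i j y, T.Adj i j → i < j → φ j y = π (i, j) (φ i y) := fun i j y hij hlt => by
    rw [hφ i j hij, if_pos hlt]; rfl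
  obtain ⟨F, hF, hE⟩ := exists_isGraphFactor_of_perm (T := T) (G := G) e φ (fun i j y hij => by
    rcases lt_or_gt_of_ne hij.ne with h | h
    · rw [hlt i j y hij h]
      exact hπ (i, j) (mem_orderedEdges.2 ⟨hij, h⟩) _
    · rw [hlt j i y hij.symm h]
      exact (hπ (j, i) (mem_orderedEdges.2 ⟨hij.symm, h⟩) (φ j y)).symm)
  refine ⟨F, hF, hE.trans ?_⟩
  ext a
  constructor
  · rintro ⟨i, j, y, hij, rfl⟩
    rcases lt_or_gt_of_ne hij.ne with h | h
    · exact ⟨(i, j), mem_orderedEdges.2 ⟨hij, h⟩, φ i y, by rw [hlt i j y hij h]⟩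
    · exact ⟨(j, i), mem_orderedEdges.2 ⟨hij.symm, h⟩, φ j y, by
        rw [hlt j i y hij.symm h, Sym2.eq_swap]⟩
  · rintro ⟨q, hq, x, rfl⟩
    obtain ⟨hadj, h⟩ := mem_orderedEdges.1 hq
    refine ⟨q.1, q.2, (φ q.1).symm x, hadj, ?_⟩
    rw [hlt q.1 q.2 _ hadj h, Equiv.apply_symm_apply]

/-- Suppose that disjoint sets `D ℓ` of edges of `G` are such that between any two classes joined in
`T` of the `ℓ`-th partition `e ℓ` the graph `D ℓ` satisfies the condition for having a `d`-regular
spanning subgraph. Then `G` has edge-disjoint `T`-factors, `d` for each `ℓ`. -/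
theorem exists_disjoint_factors [Finite V] (hT : T.IsTree) {L d : ℕ}
    (e : Fin L → (Fin t × Fin m ≃ V)) (D : Fin L → Set (Sym2 V)) (hDG : ∀ ℓ, D ℓ ⊆ G.edgeSet)
    (hD : ∀ ℓ ℓ' a, a ∈ D ℓ → a ∈ D ℓ' → ℓ = ℓ')
    (h : ∀ ℓ, ∀ q ∈ orderedEdges T, ∃ R : Finset (Fin m × Fin m),
      (∀ z ∈ R, s(e ℓ (q.1, z.1), e ℓ (q.2, z.2)) ∈ D ℓ) ∧ ∀ S S' : Finset (Fin m),
        d * (#S + #S') ≤ #{z ∈ R | z.1 ∈ S ∧ z.2 ∈ S'} + d * m) :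
    ∃ 𝓕 : Set (Set G.Subgraph), (∀ F ∈ 𝓕, IsGraphFactor T F) ∧
      𝓕.PairwiseDisjoint edgesOfFactor ∧
      L * d * #(orderedEdges T) * m ≤ (⋃ F ∈ 𝓕, edgesOfFactor F).ncard := by
  have h1 : ∀ ℓ q, ∃ π : Fin d → Equiv.Perm (Fin m), q ∈ orderedEdges T →
      (∀ k x, s(e ℓ (q.1, x), e ℓ (q.2, π k x)) ∈ D ℓ) ∧
        ∀ k l, k ≠ l → ∀ x, π k x ≠ π l x := by
    intro ℓ q
    by_cases hq : q ∈ orderedEdges T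
    · obtain ⟨R, hRD, hR⟩ := h ℓ q hq
      obtain ⟨π, h2, h3⟩ := exists_equiv_family rfl R d (by simpa using hR)
      exact ⟨π, fun _ => ⟨fun k x => hRD _ (h2 k x), h3⟩⟩
    · exact ⟨fun _ => 1, fun hq' => absurd hq' hq⟩
  choose π hπ using h1
  have h2 : ∀ z : Fin L × Fin d, ∃ F : Set G.Subgraph, IsGraphFactor T F ∧ edgesOfFactor F =
      {a | ∃ q ∈ orderedEdges T, ∃ x, a = s(e z.1 (q.1, x), e z.1 (q.2, π z.1 q z.2 x))} :=
    fun z => exists_isGraphFactor_of_matchings hT (e z.1) (fun q => π z.1 q z.2)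
      fun q hq x => hDG z.1 ((hπ z.1 q hq).1 z.2 x)
  choose F hF hFE using h2
  -- An edge determines its partition by disjointness of the `D ℓ`, then its classes and end `x`,
  -- and then its index `k` since the matchings are disjoint. This gives both the disjointness of
  -- the factors and the count of covered edges.
  have hinj : ∀ z z' : Fin L × Fin d, ∀ q ∈ orderedEdges T, ∀ q' ∈ orderedEdges T, ∀ x x',
      s(e z.1 (q.1, x), e z.1 (q.2, π z.1 q z.2 x)) =
        s(e z'.1 (q'.1, x'), e z'.1 (q'.2, π z'.1 q' z'.2 x')) → z = z' ∧ q = q' ∧ x = x' := by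
    rintro ⟨ℓ, k⟩ ⟨ℓ', k'⟩ q hq q' hq' x x' heq
    obtain rfl : ℓ = ℓ' := by
      refine hD _ _ _ ((hπ ℓ q hq).1 k x) ?_
      dsimp only at heq
      rw [heq]
      exact (hπ ℓ' q' hq').1 k' x'
    obtain ⟨h3, h4, rfl, h6⟩ := pair_eq_of_lt _ (mem_orderedEdges.1 hq).2
      (mem_orderedEdges.1 hq').2 heq
    obtain rfl : q = q' := Prod.ext h3 h4
    refine ⟨?_, rfl, rfl⟩
    by_contra hne
    exact (hπ ℓ q hq).2 k k' (fun hk => hne (by rw [hk])) x h6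
  refine ⟨Set.range F, ?_, ?_, ?_⟩
  · rintro _ ⟨z, rfl⟩
    exact hF z
  · rintro _ ⟨z, rfl⟩ _ ⟨z', rfl⟩ hne
    refine Set.disjoint_left.2 fun a ha ha' => hne ?_
    rw [hFE] at ha ha'
    obtain ⟨q, hq, x, rfl⟩ := ha
    obtain ⟨q', hq', x', heq⟩ := ha'
    rw [(hinj z z' q hq q' hq' x x' heq).1]
  · let f : (Fin L × Fin d) × (Fin t × Fin t) × Fin m → Sym2 V := fun z =>
      s(e z.1.1 (z.2.1.1, z.2.2), e z.1.1 (z.2.1.2, π z.1.1 z.2.1 z.1.2 z.2.2))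
    have hfinj : Set.InjOn f (univ ×ˢ (orderedEdges T) ×ˢ univ :
        Finset ((Fin L × Fin d) × (Fin t × Fin t) × Fin m)) := by
      rintro ⟨z, q, x⟩ hz ⟨z', q', x'⟩ hz' heq
      simp only [Finset.coe_product, Finset.coe_univ, Set.mem_prod, Set.mem_univ, true_and,
        and_true, Finset.mem_coe] at hz hz'
      obtain ⟨rfl, rfl, rfl⟩ := hinj z z' q hz q' hz' x x' heq
      rfl
    have hcard : L * d * #(orderedEdges T) * m = (f '' (univ ×ˢ (orderedEdges T) ×ˢ univ :
        Finset ((Fin L × Fin d) × (Fin t × Fin t) × Fin m))).ncard := by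
      rw [hfinj.ncard_image, Set.ncard_coe_finset, Finset.card_product,
        Finset.card_product]
      simp [mul_assoc]
    rw [hcard]
    refine Set.ncard_le_ncard ?_ (Set.toFinite _)
    rintro _ ⟨⟨z, q, x⟩, hz, rfl⟩
    simp only [Finset.coe_product, Finset.coe_univ, Set.mem_prod, Set.mem_univ, true_and,
      and_true, Finset.mem_coe] at hz
    simp only [Set.mem_range, Set.iUnion_exists, Set.iUnion_iUnion_eq', Set.mem_iUnion]
    refine ⟨z, ?_⟩
    rw [hFE]
    exact ⟨q, hz, x, rfl⟩

end TreeFactor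

/-! ### Independence in product spaces and uniform measures. -/

section ProductSpaces

lemma iIndepSet_pi {ι X : Type*} [Fintype ι] [MeasurableSpace X] (ν : Measure X)
    [IsProbabilityMeasure ν] {A : ι → Set X} (hA : ∀ i, MeasurableSet (A i)) :
    iIndepSet (fun i => {ω : ι → X | ω i ∈ A i}) (Measure.pi fun _ => ν) := by
  refine (iIndepSet_iff_meas_biInter fun i => measurable_pi_apply i (hA i)).2 fun s => ?_
  exact (iIndepFun_pi (μ := fun _ : ι => ν) (X := fun _ x => x)
    fun _ => aemeasurable_id).measure_inter_preimage_eq_mul s fun i _ => hA i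

lemma measureReal_pi_eval {ι X : Type*} [Fintype ι] [MeasurableSpace X] (ν : Measure X)
    [IsProbabilityMeasure ν] {A : Set X} (hA : MeasurableSet A) (i : ι) :
    (Measure.pi fun _ : ι => ν).real {ω | ω i ∈ A} = ν.real A :=
  (measurePreserving_eval (fun _ : ι => ν) i).measureReal_preimage hA.nullMeasurableSet

lemma measureReal_uniformOn_univ {X : Type*} [Fintype X] [MeasurableSpace X]
    [MeasurableSingletonClass X] (A : Set X) [DecidablePred (· ∈ A)] :
    (uniformOn (Set.univ : Set X)).real A = #{x | x ∈ A} / Fintype.card X := by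
  classical
  rw [measureReal_def, uniformOn_univ, Measure.count_apply_finite _ (Set.toFinite A)]
  simp only [ENNReal.toReal_div, ENNReal.toReal_natCast]
  congr 2
  congr 1
  ext x
  simp

end ProductSpaces

/-! ### Edges of the binomial random graph are independent. -/

section BinomialRandom

open SimpleGraph unitInterval

variable {V : Type*}

lemma measurableSet_mem_edgeSet (a : Sym2 V) :
    MeasurableSet {G : SimpleGraph V | a ∈ G.edgeSet} :=
  measurable_edgeSet (measurableSet_setOfPred.2 (measurable_set_mem a))

variable [Finite V] (p : I)

/-- The random graph is the image of a product measure on subsets of `Sym2 V`, with diagonal pairs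
discarded; the product over `s` is what yields independence. -/
lemma binomialRandom_biInter_mem_edgeSet (s : Finset (Sym2 V)) :
    binomialRandom V p (⋂ a ∈ s, {G | a ∈ G.edgeSet}) =
      ∏ a ∈ s, (toNNReal p • Measure.dirac (a ∈ (Sym2.diagSetᶜ : Set (Sym2 V))) +
        toNNReal (σ p) • Measure.dirac False) {b | b ∧ ¬ a.IsDiag} := by
  have hm : MeasurableSet (⋂ a ∈ s, {G : SimpleGraph V | a ∈ G.edgeSet}) :=
    Finset.measurableSet_biInter s fun a _ => measurableSet_mem_edgeSet a
  have hm' : Measurable fun ω : Sym2 V → Prop => {a | ω a} :=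
    MeasurableEquiv.setOfPred.measurable
  rw [binomialRandom_eq_map, Measure.map_apply measurable_fromEdgeSet hm, setBernoulli_eq_map,
    Measure.map_apply hm' (measurable_fromEdgeSet hm), ← Measure.infinitePi_pi]
  · congr 1
    ext ω
    simp [Set.mem_pi]
  · exact fun _ _ => MeasurableSet.of_discrete

lemma binomialRandom_mem_edgeSet (a : Sym2 V) :
    binomialRandom V p {G | a ∈ G.edgeSet} =
      (toNNReal p • Measure.dirac (a ∈ (Sym2.diagSetᶜ : Set (Sym2 V))) +
        toNNReal (σ p) • Measure.dirac False) {b | b ∧ ¬ a.IsDiag} := by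
  simpa using binomialRandom_biInter_mem_edgeSet p {a}

lemma iIndepSet_mem_edgeSet :
    iIndepSet (fun a : Sym2 V => {G : SimpleGraph V | a ∈ G.edgeSet}) (binomialRandom V p) := by
  refine (iIndepSet_iff_meas_biInter measurableSet_mem_edgeSet).2 fun s => ?_
  rw [binomialRandom_biInter_mem_edgeSet]
  exact Finset.prod_congr rfl fun a _ => (binomialRandom_mem_edgeSet p a).symm

lemma binomialRandom_real_mem_edgeSet {a : Sym2 V} (ha : ¬ a.IsDiag) :
    (binomialRandom V p).real {G | a ∈ G.edgeSet} = p := by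
  rw [measureReal_def, binomialRandom_mem_edgeSet]
  simp [ha]

end BinomialRandom

/-! ### Random equitable partitions. -/

section Crossing

variable {t m : ℕ} {V : Type*} (T : SimpleGraph (Fin t))

/-- The pairs of vertices whose classes, in the partition of `V` into `t` classes given by `e`, are
joined by an edge of `T`. -/
def crossing (e : Fin t × Fin m ≃ V) : Set (Sym2 V) :=
  (T.comap fun v => (e.symm v).1).edgeSet

variable {T}

lemma mk_mem_crossing {e : Fin t × Fin m ≃ V} {u v : V} :
    s(u, v) ∈ crossing T e ↔ T.Adj (e.symm u).1 (e.symm v).1 := Iff.rfl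

lemma not_isDiag_of_mem_crossing {e : Fin t × Fin m ≃ V} {a : Sym2 V} (ha : a ∈ crossing T e) :
    ¬ a.IsDiag := SimpleGraph.not_isDiag_of_mem_edgeSet _ ha

lemma exists_perm_pair [DecidableEq V] {u v u' v' : V} (h : u ≠ v) (h' : u' ≠ v') :
    ∃ τ : Equiv.Perm V, τ u = u' ∧ τ v = v' := by
  refine ⟨Equiv.swap (Equiv.swap u u' v) v' * Equiv.swap u u', ?_, ?_⟩
  · have h1 : u' ≠ Equiv.swap u u' v := fun heq =>
      h ((Equiv.swap u u').injective ((Equiv.swap_apply_left u u').trans heq))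
    simp only [Equiv.Perm.mul_apply, Equiv.swap_apply_left]
    exact Equiv.swap_apply_of_ne_of_ne h1 h'
  · simp

lemma card_adj_pairs [DecidableRel T.Adj] :
    #{q : Fin t × Fin t | T.Adj q.1 q.2} = 2 * #(orderedEdges T) := by
  have h1 : ({q : Fin t × Fin t | T.Adj q.1 q.2} : Finset _) =
      orderedEdges T ∪ (orderedEdges T).map (Equiv.prodComm _ _).toEmbedding := by
    ext ⟨i, j⟩
    simp only [Finset.mem_filter, Finset.mem_univ, true_and, Finset.mem_union, Finset.mem_map_equiv,
      mem_orderedEdges]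
    simp only [Equiv.prodComm_symm, Equiv.prodComm_apply, Prod.swap, T.adj_comm j i]
    constructor
    · intro h
      rcases lt_or_gt_of_ne h.ne with hlt | hlt
      · exact .inl ⟨h, hlt⟩
      · exact .inr ⟨h, hlt⟩
    · rintro (h | h) <;> exact h.1
  rw [h1, Finset.card_union_of_disjoint, Finset.card_map, two_mul]
  rw [Finset.disjoint_left]
  rintro ⟨i, j⟩ h h'
  rw [Finset.mem_map_equiv] at h'
  exact (mem_orderedEdges.1 h).2.asymm (mem_orderedEdges.1 h').2

variable [Fintype V] [DecidableEq V]

lemma card_crossing_eq [DecidableRel T.Adj] {u v u' v' : V} (h : u ≠ v) (h' : u' ≠ v') :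
    #{e : Fin t × Fin m ≃ V | T.Adj (e.symm u).1 (e.symm v).1} =
      #{e : Fin t × Fin m ≃ V | T.Adj (e.symm u').1 (e.symm v').1} := by
  obtain ⟨τ, rfl, rfl⟩ := exists_perm_pair h h'
  refine Finset.card_equiv (Equiv.equivCongr (Equiv.refl _) τ) fun e => ?_
  simp

/-- Double counting of partitions and ordered pairs: each partition has `2 m²` crossing ordered
pairs per edge of `T`, and by symmetry all pairs of distinct vertices cross equally often. -/
lemma card_crossing_mul [DecidableRel T.Adj] {u v : V} (h : u ≠ v) :
    #{e : Fin t × Fin m ≃ V | T.Adj (e.symm u).1 (e.symm v).1} *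
      (Fintype.card V * (Fintype.card V - 1)) =
      2 * #(orderedEdges T) * m ^ 2 * Fintype.card (Fin t × Fin m ≃ V) := by
  have h1 : ∑ z ∈ (univ : Finset V).offDiag,
      #{e : Fin t × Fin m ≃ V | T.Adj (e.symm z.1).1 (e.symm z.2).1} =
      ∑ e : Fin t × Fin m ≃ V, 2 * #(orderedEdges T) * m ^ 2 := by
    simp_rw [Finset.card_filter]
    rw [Finset.sum_comm]
    refine Finset.sum_congr rfl fun e _ => ?_
    rw [← Finset.card_filter, ← card_adj_pairs]
    have h2 : #((univ : Finset V).offDiag.filter fun z => T.Adj (e.symm z.1).1 (e.symm z.2).1) =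
        #(((univ : Finset (Fin t × Fin t)).filter fun q => T.Adj q.1 q.2) ×ˢ (univ : Finset (Fin m × Fin m))) := by
      refine Finset.card_equiv ((Equiv.prodCongr e.symm e.symm).trans
        (Equiv.prodProdProdComm _ _ _ _)) fun z => ?_
      simp only [Finset.mem_filter, Finset.mem_offDiag, Finset.mem_univ, true_and,
        Finset.mem_product, and_true]
      refine ⟨fun h => h.2, fun h => ⟨fun heq => T.irrefl (v := (e.symm z.2).1) ?_, h⟩⟩
      change T.Adj (e.symm z.1).1 (e.symm z.2).1 at h
      rwa [heq] at h
    rw [h2, Finset.card_product]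
    simp [sq]
  rw [Finset.sum_congr rfl fun z hz => card_crossing_eq (T := T) (m := m)
    (Finset.mem_offDiag.1 hz).2.2 h, Finset.sum_const, Finset.sum_const, Finset.offDiag_card,
    Finset.card_univ, Finset.card_univ, smul_eq_mul, smul_eq_mul] at h1
  rw [mul_comm, Nat.mul_sub_one, h1, mul_comm]

/-- If `L` is large, then there are `L` equitable partitions of `V` such that no pair of vertices is
crossing in many more of them than the average. -/
theorem exists_partitions (e₀ : Fin t × Fin m ≃ V) (L : ℕ) {q δ : ℝ}
    (hq : q * (Fintype.card V * (Fintype.card V - 1)) = 2 * #(orderedEdges T) * m ^ 2)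
    (hq0 : 0 ≤ q) (hδ : 0 ≤ δ) (hδ1 : δ ≤ 1)
    (hL : (Fintype.card V : ℝ) ^ 2 * Real.exp (-(δ ^ 2 * (q * L) / 4)) < 1) :
    ∃ e : Fin L → (Fin t × Fin m ≃ V), ∀ a : Sym2 V,
      ({ℓ | a ∈ crossing T (e ℓ)}.ncard : ℝ) ≤ (1 + δ) * (q * L) := by
  classical
  let X := Fin t × Fin m ≃ V
  let _ : MeasurableSpace X := ⊤
  have : Nonempty X := ⟨e₀⟩
  have : MeasurableSingletonClass X := ⟨fun _ => trivial⟩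
  let ν : Measure X := uniformOn Set.univ
  let A : V × V → Set X := fun z => {e | s(z.1, z.2) ∈ crossing T e}
  have hAm : ∀ z, MeasurableSet (A z) := fun _ => trivial
  have hA : ∀ z : V × V, z.1 ≠ z.2 → ν.real (A z) = q := by
    intro z hz
    have hcard2 : 1 < Fintype.card V := Fintype.one_lt_card_iff.2 ⟨_, _, hz⟩
    have h1 := card_crossing_mul (T := T) (m := m) hz
    rw [measureReal_uniformOn_univ]
    have hX : (0 : ℝ) < Fintype.card X := by exact_mod_cast Fintype.card_pos
    have hn : (1 : ℝ) < Fintype.card V := by exact_mod_cast hcard2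
    have hn' : (0 : ℝ) < Fintype.card V * (Fintype.card V - 1) := by nlinarith
    rw [div_eq_iff hX.ne']
    refine mul_right_cancel₀ hn'.ne' ?_
    have h2 : ((#{e : X | T.Adj (e.symm z.1).1 (e.symm z.2).1} : ℕ) : ℝ) *
        (Fintype.card V * (Fintype.card V - 1)) =
        2 * #(orderedEdges T) * m ^ 2 * Fintype.card X := by
      have := congrArg (Nat.cast (R := ℝ)) h1
      push_cast [Nat.cast_sub hcard2.le] at this
      exact this
    rw [← hq] at h2
    have h3 : #{x : X | x ∈ A z} = #{e : X | T.Adj (e.symm z.1).1 (e.symm z.2).1} := by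
      congr 1
    rw [h3, h2]; ring
  let P : Measure (Fin L → X) := Measure.pi fun _ => ν
  have : IsProbabilityMeasure P := inferInstanceAs (IsProbabilityMeasure (Measure.pi fun _ => ν))
  let B : V × V → Set (Fin L → X) := fun z =>
    {ω | (1 + δ) * (q * L) < (hitCount (fun ℓ => {ω : Fin L → X | ω ℓ ∈ A z}) univ ω : ℝ)}
  have hB : ∀ z : V × V, z.1 ≠ z.2 → P.real (B z) ≤ Real.exp (-(δ ^ 2 * (q * L) / 4)) := by
    intro z hz
    refine measureReal_lt_hitCount_le (x := q) (fun ℓ => measurable_pi_apply ℓ (hAm z))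
      (iIndepSet_pi ν fun _ => hAm z) univ (fun ℓ _ => ?_) (by simp) hδ hδ1
    rw [← hA z hz]
    exact measureReal_pi_eval ν (hAm z) ℓ
  -- Union bound over at most `n²` ordered pairs.
  have hU : P.real (⋃ z ∈ (univ : Finset V).offDiag, B z) < 1 := by
    refine lt_of_le_of_lt ((measureReal_biUnion_finset_le _ _).trans (Finset.sum_le_sum
      fun z hz => hB z (Finset.mem_offDiag.1 hz).2.2)) (lt_of_le_of_lt ?_ hL)
    rw [Finset.sum_const, nsmul_eq_mul]
    gcongr
    rw [Finset.offDiag_card, Finset.card_univ]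
    exact_mod_cast (Nat.sub_le _ _).trans (by rw [sq])
  obtain ⟨e, he⟩ : ∃ e, e ∉ ⋃ z ∈ (univ : Finset V).offDiag, B z := by
    by_contra hcon
    push Not at hcon
    rw [Set.eq_univ_of_forall hcon] at hU
    simp at hU
  refine ⟨e, fun a => ?_⟩
  induction a with
  | _ u v =>
  by_cases huv : u = v
  · subst huv
    have : {ℓ | s(u, u) ∈ crossing T (e ℓ)} = ∅ := by
      ext ℓ
      simp [mk_mem_crossing]
    rw [this]
    rw [Set.ncard_empty, Nat.cast_zero]
    positivity
  · have h1 : ¬ (1 + δ) * (q * L) <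
        (hitCount (fun ℓ => {ω : Fin L → X | ω ℓ ∈ A (u, v)}) univ e : ℝ) :=
      fun hmem => he (Set.mem_biUnion (x := (u, v)) (by simpa using huv) hmem)
    refine le_trans (le_of_eq ?_) (not_lt.1 h1)
    rw [hitCount, ← Set.ncard_coe_finset]
    congr 2
    ext ℓ
    simp [A]

end Crossing

/-! ### Distributing the vertex pairs among the partitions. -/

section Assignment

variable {t m : ℕ} {V : Type*} {T : SimpleGraph (Fin t)}

lemma mk_mem_crossing_of_orderedEdges (e : Fin t × Fin m ≃ V) {q : Fin t × Fin t}
    (hq : q ∈ orderedEdges T) (x y : Fin m) : s(e (q.1, x), e (q.2, y)) ∈ crossing T e := by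
  rw [mk_mem_crossing]
  simpa using (mem_orderedEdges.1 hq).1

lemma injective_pair (e : Fin t × Fin m ≃ V) {q : Fin t × Fin t} (hq : q ∈ orderedEdges T) :
    Function.Injective fun z : Fin m × Fin m => s(e (q.1, z.1), e (q.2, z.2)) := by
  intro z z' h
  have hlt := (mem_orderedEdges.1 hq).2
  obtain ⟨-, -, h1, h2⟩ := pair_eq_of_lt e hlt hlt h
  exact Prod.ext h1 h2

lemma card_orderedEdges_le : #(orderedEdges T) ≤ t ^ 2 := by
  refine (Finset.card_le_univ _).trans ?_
  simp [sq]

/-- A union bound over the partitions and over the edges of the tree. -/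
lemma measureReal_iUnion_orderedEdges_le {Ω : Type*} [MeasurableSpace Ω] {μ : Measure Ω}
    [IsProbabilityMeasure μ] {L : ℕ} (B : Fin L → Fin t × Fin t → Set Ω) {x : ℝ} (hx : 0 ≤ x)
    (hB : ∀ ℓ, ∀ q ∈ orderedEdges T, μ.real (B ℓ q) ≤ x) :
    μ.real (⋃ z ∈ (univ : Finset (Fin L)) ×ˢ orderedEdges T, B z.1 z.2) ≤ L * t ^ 2 * x := by
  refine (measureReal_biUnion_finset_le _ _).trans ((Finset.sum_le_sum fun z hz =>
    hB z.1 z.2 (Finset.mem_product.1 hz).2).trans ?_)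
  rw [Finset.sum_const, nsmul_eq_mul, Finset.card_product, Finset.card_univ, Fintype.card_fin]
  gcongr
  exact_mod_cast Nat.mul_le_mul_left L card_orderedEdges_le

variable [Fintype V]

/-- If every pair of vertices is crossing in at most `M` of the partitions `e ℓ`, then the pairs can
be distributed to the partitions so that each of the bipartite graphs obtained has density about
`1 / M` on all large rectangles. -/
theorem exists_assignment {L M : ℕ} (hM : 0 < M) (e : Fin L → (Fin t × Fin m ≃ V))
    (he : ∀ a : Sym2 V, {ℓ | a ∈ crossing T (e ℓ)}.ncard ≤ M) {δ : ℝ} (hδ : 0 ≤ δ) (hδ1 : δ ≤ 1)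
    (hr : 2 * m * Real.exp (-(δ ^ 2 * (1 / M) * 1 * m / 16)) ≤ 1)
    (hL : L * t ^ 2 * (8 * m * Real.exp (-(δ ^ 2 * (1 / M) * 1 * m / 16))) < 1) :
    ∃ D : Fin L → Set (Sym2 V), (∀ ℓ ℓ' a, a ∈ D ℓ → a ∈ D ℓ' → ℓ = ℓ') ∧
      ∀ ℓ, ∀ q ∈ orderedEdges T, ∃ W : Finset (Fin m × Fin m),
        (∀ z ∈ W, s(e ℓ (q.1, z.1), e ℓ (q.2, z.2)) ∈ D ℓ) ∧
        ∀ S S' : Finset (Fin m), m < #S + #S' →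
          (1 - δ) / M * (#S * #S') ≤ #(W ∩ S ×ˢ S') := by
  classical
  -- The partitions crossed by `a` get distinct labels among `M`. A uniform label then selects each
  -- of them with probability exactly `1 / M`, however many there are; an unused label leaves `a`
  -- unassigned.
  have hc : ∀ a : Sym2 V, ∃ c : Fin L → Fin M, Set.InjOn c {ℓ | a ∈ crossing T (e ℓ)} := by
    intro a
    have : Nonempty (Fin M) := ⟨⟨0, hM⟩⟩
    have h1 : Set.encard {ℓ | a ∈ crossing T (e ℓ)} ≤ (Set.univ : Set (Fin M)).encard := by
      have h2 : (Set.univ : Set (Fin M)).encard = M := by simp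
      rw [h2, ← (Set.toFinite _).cast_ncard_eq]
      exact_mod_cast he a
    obtain ⟨f, -, hf⟩ := Set.Finite.exists_injOn_of_encard_le (Set.toFinite _) h1
    exact ⟨f, hf⟩
  choose c hc using hc
  have : Nonempty (Fin M) := ⟨⟨0, hM⟩⟩
  let ν : Measure (Fin M) := uniformOn Set.univ
  let P : Measure (Sym2 V → Fin M) := Measure.pi fun _ => ν
  have : IsProbabilityMeasure P := inferInstanceAs (IsProbabilityMeasure (Measure.pi fun _ => ν))
  have hν : ∀ i, ν.real {i} = 1 / M := fun i => by
    rw [measureReal_uniformOn_univ, Fintype.card_fin]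
    congr 1
    exact_mod_cast Finset.card_eq_one.2 ⟨i, by ext; simp⟩
  let pr : Fin L → Fin t × Fin t → Fin m × Fin m → Sym2 V := fun ℓ q z =>
    s(e ℓ (q.1, z.1), e ℓ (q.2, z.2))
  let E : Fin L → Fin t × Fin t → Fin m × Fin m → Set (Sym2 V → Fin M) := fun ℓ q z =>
    {ω | ω (pr ℓ q z) ∈ ({c (pr ℓ q z) ℓ} : Set (Fin M))}
  let B : Fin L → Fin t × Fin t → Set (Sym2 V → Fin M) := fun ℓ q =>
    {ω | ∃ S S' : Finset (Fin m), m < #S + #S' ∧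
      (hitCount (E ℓ q) (univ ∩ S ×ˢ S') ω : ℝ) < (1 - δ) * (1 / M * 1 * (#S * #S'))}
  have hB : ∀ ℓ, ∀ q ∈ orderedEdges T,
      P.real (B ℓ q) ≤ 8 * m * Real.exp (-(δ ^ 2 * (1 / M) * 1 * m / 16)) := by
    intro ℓ q hq
    refine measureReal_exists_rectangle_le (fun z => measurable_pi_apply _ (.singleton _)) ?_ univ
      (by positivity) zero_le_one (fun z _ => ?_) (fun S S' _ => ?_) hδ hδ1 hr
    · exact iIndepSet_preimage (iIndepSet_pi ν (A := fun a => {c a ℓ}) fun a => .singleton _)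
        (injective_pair (e ℓ) hq)
    · rw [← hν (c (pr ℓ q z) ℓ)]
      exact measureReal_pi_eval ν (.singleton _) _
    · rw [Finset.univ_inter, Finset.card_product]; simp
  obtain ⟨ω, hω⟩ : ∃ ω, ω ∉ ⋃ z ∈ (univ : Finset (Fin L)) ×ˢ orderedEdges T, B z.1 z.2 := by
    by_contra hcon
    push Not at hcon
    have := lt_of_le_of_lt (measureReal_iUnion_orderedEdges_le B (by positivity) hB) hL
    rw [Set.eq_univ_of_forall hcon] at this
    simp at this
  refine ⟨fun ℓ => {a | a ∈ crossing T (e ℓ) ∧ ω a = c a ℓ}, ?_, fun ℓ q hq => ?_⟩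
  · rintro ℓ ℓ' a ⟨h1, h2⟩ ⟨h3, h4⟩
    exact hc a h1 h3 (h2.symm.trans h4)
  · refine ⟨univ.filter fun z => ω (pr ℓ q z) = c (pr ℓ q z) ℓ, fun z hz => ?_, fun S S' hS => ?_⟩
    · exact ⟨mk_mem_crossing_of_orderedEdges _ hq _ _, (Finset.mem_filter.1 hz).2⟩
    · have h1 : ω ∉ B ℓ q := fun hmem => hω (Set.mem_biUnion (x := (ℓ, q)) (by simpa using hq) hmem)
      have h2 : ¬ (hitCount (E ℓ q) (univ ∩ S ×ˢ S') ω : ℝ) < (1 - δ) * (1 / M * 1 * (#S * #S')) :=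
        fun hlt => h1 ⟨S, S', hS, hlt⟩
      refine le_trans (le_of_eq (by ring)) ((not_lt.1 h2).trans (le_of_eq ?_))
      rw [hitCount]
      congr 2
      ext z
      simp [E, and_comm]

end Assignment

/-! ### Factors and number of edges in the random graph. -/

section RandomSubgraph

open SimpleGraph

variable {t m : ℕ} {V : Type*} [Fintype V] {T : SimpleGraph (Fin t)}

/-- Only `a + b > m` needs an argument, and then `ab ≥ m(a + b - m)` because `(m - a)(m - b) ≥ 0`.
This turns density on large rectangles into the hypothesis of `exists_regular_subset`. -/
lemma le_card_add_of_rectangle {m d : ℕ} {y : ℝ} (hy : 0 ≤ y) (hd : d ≤ y * m) {a b k : ℕ}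
    (ha : a ≤ m) (hb : b ≤ m) (hk : m < a + b → y * (a * b) ≤ k) : d * (a + b) ≤ k + d * m := by
  rcases le_or_gt (a + b) m with h | h
  · exact (Nat.mul_le_mul_left d h).trans (Nat.le_add_left _ _)
  · have ha' : (a : ℝ) ≤ m := by exact_mod_cast ha
    have hb' : (b : ℝ) ≤ m := by exact_mod_cast hb
    have h' : (m : ℝ) < a + b := by exact_mod_cast h
    have h1 : (d : ℝ) * (a + b - m) ≤ y * m * (a + b - m) :=
      mul_le_mul_of_nonneg_right hd (by linarith)
    have h2 : y * (m * (a + b - m)) ≤ y * (a * b) :=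
      mul_le_mul_of_nonneg_left (by nlinarith) hy
    have h3 : (d : ℝ) * (a + b) ≤ k + d * m := by linarith [hk h]
    exact_mod_cast h3

/-- A random graph contains, with high probability, `d` edge-disjoint factors for each of the
partitions `e ℓ`. -/
theorem binomialRandom_no_factors_le (hT : T.IsTree) (p : unitInterval) {L d : ℕ}
    (e : Fin L → (Fin t × Fin m ≃ V)) {D : Fin L → Set (Sym2 V)}
    (hD : ∀ ℓ ℓ' a, a ∈ D ℓ → a ∈ D ℓ' → ℓ = ℓ') {w δ : ℝ} (hw0 : 0 ≤ w)
    (hW : ∀ ℓ, ∀ q ∈ orderedEdges T, ∃ W : Finset (Fin m × Fin m),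
        (∀ z ∈ W, s(e ℓ (q.1, z.1), e ℓ (q.2, z.2)) ∈ D ℓ) ∧
        ∀ S S' : Finset (Fin m), m < #S + #S' → w * (#S * #S') ≤ #(W ∩ S ×ˢ S'))
    (hδ : 0 ≤ δ) (hδ1 : δ ≤ 1) (hd : d ≤ (1 - δ) * (p * w) * m)
    (hr : 2 * m * Real.exp (-(δ ^ 2 * p * w * m / 16)) ≤ 1) :
    (binomialRandom V p).real {G | ¬ ∃ 𝓕 : Set (Set G.Subgraph), (∀ F ∈ 𝓕, IsGraphFactor T F) ∧
      𝓕.PairwiseDisjoint edgesOfFactor ∧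
      L * d * #(orderedEdges T) * m ≤ (⋃ F ∈ 𝓕, edgesOfFactor F).ncard} ≤
      L * t ^ 2 * (8 * m * Real.exp (-(δ ^ 2 * p * w * m / 16))) := by
  classical
  have hp0 : (0 : ℝ) ≤ p := p.2.1
  have hW' : ∀ ℓ q, ∃ W : Finset (Fin m × Fin m), q ∈ orderedEdges T →
        (∀ z ∈ W, s(e ℓ (q.1, z.1), e ℓ (q.2, z.2)) ∈ D ℓ) ∧
        ∀ S S' : Finset (Fin m), m < #S + #S' → w * (#S * #S') ≤ #(W ∩ S ×ˢ S') := by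
    intro ℓ q
    by_cases hq : q ∈ orderedEdges T
    · obtain ⟨W, h⟩ := hW ℓ q hq
      exact ⟨W, fun _ => h⟩
    · exact ⟨∅, fun h => absurd h hq⟩
  choose W hW using hW'
  let pr : Fin L → Fin t × Fin t → Fin m × Fin m → Sym2 V := fun ℓ q z =>
    s(e ℓ (q.1, z.1), e ℓ (q.2, z.2))
  let E : Fin L → Fin t × Fin t → Fin m × Fin m → Set (SimpleGraph V) := fun ℓ q z =>
    {G | pr ℓ q z ∈ G.edgeSet}
  let B : Fin L → Fin t × Fin t → Set (SimpleGraph V) := fun ℓ q =>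
    {G | ∃ S S' : Finset (Fin m), m < #S + #S' ∧
      (hitCount (E ℓ q) (W ℓ q ∩ S ×ˢ S') G : ℝ) < (1 - δ) * (p * w * (#S * #S'))}
  have hB : ∀ ℓ, ∀ q ∈ orderedEdges T, (binomialRandom V p).real (B ℓ q) ≤
      8 * m * Real.exp (-(δ ^ 2 * p * w * m / 16)) := by
    intro ℓ q hq
    refine measureReal_exists_rectangle_le (fun z => measurableSet_mem_edgeSet _) ?_ (W ℓ q)
      hp0 hw0 (fun z _ => ?_) (hW ℓ q hq).2 hδ hδ1 hr
    · exact iIndepSet_preimage (iIndepSet_mem_edgeSet p) (injective_pair (e ℓ) hq)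
    · exact binomialRandom_real_mem_edgeSet p
        (not_isDiag_of_mem_crossing (mk_mem_crossing_of_orderedEdges (e ℓ) hq _ _))
  refine (measureReal_mono ?_ (measure_ne_top _ _)).trans
    (measureReal_iUnion_orderedEdges_le B (by positivity) hB)
  intro G hG
  by_contra hmem
  refine hG (exists_disjoint_factors hT e (fun ℓ => D ℓ ∩ G.edgeSet)
    (fun ℓ => Set.inter_subset_right) (fun ℓ ℓ' a h h' => hD ℓ ℓ' a h.1 h'.1) fun ℓ q hq => ?_)
  refine ⟨{z ∈ W ℓ q | pr ℓ q z ∈ G.edgeSet}, fun z hz => ?_, fun S S' => ?_⟩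
  · exact ⟨(hW ℓ q hq).1 z (Finset.mem_filter.1 hz).1, (Finset.mem_filter.1 hz).2⟩
  · refine le_card_add_of_rectangle (y := (1 - δ) * (p * w))
      (mul_nonneg (by linarith) (mul_nonneg hp0 hw0)) hd (by simpa using Finset.card_le_univ S)
      (by simpa using Finset.card_le_univ S') fun hS => ?_
    have h1 : G ∉ B ℓ q := fun h => hmem (Set.mem_biUnion (x := (ℓ, q)) (by simpa using hq) h)
    have h2 : ¬ (hitCount (E ℓ q) (W ℓ q ∩ S ×ˢ S') G : ℝ) < (1 - δ) * (p * w * (#S * #S')) :=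
      fun hlt => h1 ⟨S, S', hS, hlt⟩
    refine le_trans (le_of_eq (by ring)) ((not_lt.1 h2).trans (le_of_eq ?_))
    rw [hitCount]
    congr 2
    ext z
    simp only [Finset.mem_filter, Finset.mem_inter, Finset.mem_product, E, Set.mem_ofPred_eq]
    tauto

/-- The number of edges of a random graph is not much larger than its mean. -/
theorem binomialRandom_card_edgeSet_gt_le (p : unitInterval) {N δ : ℝ}
    (hN : 2 * N = Fintype.card V * (Fintype.card V - 1)) (hδ : 0 ≤ δ) (hδ1 : δ ≤ 1) :
    (binomialRandom V p).real {G | (1 + δ) * (p * N) < (G.edgeSet.ncard : ℝ)} ≤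
      Real.exp (-(δ ^ 2 * (p * N) / 4)) := by
  classical
  let s : Finset (Sym2 V) := {a | ¬ a.IsDiag}
  have hs : (#s : ℝ) = N := by
    have h1 : #s = (Fintype.card V).choose 2 := by
      rw [← Sym2.card_subtype_not_diag, Fintype.card_subtype]
    rw [h1, Nat.cast_choose_two]
    linarith
  have h := measureReal_lt_hitCount_le (μ := binomialRandom V p)
    (D := fun a : Sym2 V => {G : SimpleGraph V | a ∈ G.edgeSet}) measurableSet_mem_edgeSet
    (iIndepSet_mem_edgeSet p) s (x := p) (b := p * N)
    (fun a ha => binomialRandom_real_mem_edgeSet p (Finset.mem_filter.1 ha).2) (by rw [hs]) hδ hδ1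
  refine le_trans (le_of_eq ?_) h
  congr 1
  ext G
  have h1 : G.edgeSet.ncard = hitCount (fun a : Sym2 V => {G : SimpleGraph V | a ∈ G.edgeSet}) s G := by
    rw [hitCount, ← Set.ncard_coe_finset]
    congr 1
    ext a
    simp only [Finset.coe_filter, s, Finset.mem_filter, Finset.mem_univ, true_and,
      Set.mem_ofPred_eq]
    exact ⟨fun h => ⟨G.not_isDiag_of_mem_edgeSet h, h⟩, fun h => h.2⟩
  simp only [Set.mem_ofPred_eq, h1]

end RandomSubgraph

/-! ### Numerical estimates. -/

section Parameters

lemma exp_neg_le_inv_pow {n A : ℝ} (hn : 0 < n) (k : ℕ) (h : k * Real.log n ≤ A) :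
    Real.exp (-A) ≤ 1 / n ^ k := by
  calc Real.exp (-A) ≤ Real.exp (-(k * Real.log n)) := Real.exp_le_exp.2 (by linarith)
    _ = 1 / n ^ k := by rw [Real.exp_neg, Real.exp_nat_mul, Real.exp_log hn, one_div]

/-- Factors covering almost as many edges as the graph has witness `CoverableByFactors`. -/
lemma coverableByFactors_of_le {W V : Type*} [Finite V] {H : SimpleGraph W} {G : SimpleGraph V}
    {𝓕 : Set (Set G.Subgraph)} (h1 : ∀ F ∈ 𝓕, IsGraphFactor H F)
    (h2 : 𝓕.PairwiseDisjoint edgesOfFactor) {δ : ℝ}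
    (h3 : (1 - δ) * (G.edgeSet.ncard : ℝ) ≤ (⋃ F ∈ 𝓕, edgesOfFactor F).ncard) :
    CoverableByFactors H δ G := by
  refine ⟨𝓕, h1, h2, ?_⟩
  have hsub : ⋃ F ∈ 𝓕, edgesOfFactor F ⊆ G.edgeSet :=
    Set.iUnion₂_subset fun F _ => Set.iUnion₂_subset fun K _ => K.edgeSet_subset
  have h4 := Set.ncard_sdiff_add_ncard_of_subset hsub
  have h5 : ((G.edgeSet \ ⋃ F ∈ 𝓕, edgesOfFactor F).ncard : ℝ) +
      (⋃ F ∈ 𝓕, edgesOfFactor F).ncard = G.edgeSet.ncard := by exact_mod_cast h4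
  linarith

lemma coverableByFactors_of_one_le {W V : Type*} [Finite V] {H : SimpleGraph W} {G : SimpleGraph V}
    {δ : ℝ} (hδ : 1 ≤ δ) : CoverableByFactors H δ G :=
  coverableByFactors_of_le (𝓕 := ∅) (by simp) (by simp) (by
    simp only [Set.mem_empty_iff_false, Set.iUnion_of_empty, Set.iUnion_empty, Set.ncard_empty,
      Nat.cast_zero]
    exact mul_nonpos_of_nonpos_of_nonneg (by linarith) (Nat.cast_nonneg _))

/-- The probability that a pair of vertices is crossing in a random equitable partition. -/
lemma crossing_probability_bounds {t m s q : ℝ} (ht : 2 ≤ t) (hm : 1 ≤ m) (hs : s + 1 = t)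
    (hq : q * ((t * m) * (t * m - 1)) = 2 * s * m ^ 2) : 1 / t ≤ q ∧ q ≤ 1 := by
  have h0 : 0 < (t * m) * (t * m - 1) := by
    have : 2 ≤ t * m := by nlinarith
    nlinarith
  obtain rfl : s = t - 1 := by linarith
  constructor
  · rw [div_le_iff₀ (by linarith)]
    refine le_of_mul_le_mul_right ?_ h0
    have h1 : 0 ≤ t * (t - 2) * m ^ 2 := by
      have := sub_nonneg.2 ht
      positivity
    have h2 : 0 ≤ t * m := by positivity
    nlinarith
  · refine le_of_mul_le_mul_right ?_ h0
    have h1 : 0 ≤ (t - 1) * (t - 2) * m ^ 2 :=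
      mul_nonneg (mul_nonneg (by linarith) (by linarith)) (sq_nonneg m)
    have h2 : t * m ≤ t * m ^ 2 := mul_le_mul_of_nonneg_left (by nlinarith) (by linarith)
    nlinarith

/-- The total number of edges in the factors compared with the number of edges of the graph. -/
lemma one_sub_mul_le_covered {ε p m M L q N s d E : ℝ} (hε : 0 < ε) (hε1 : ε < 1 / 5) (hp : 0 ≤ p)
    (hm : 0 ≤ m) (hM : 0 < M) (hq : 0 < q) (hs : 0 ≤ s) (hML : M ≤ (1 + ε) * (q * L))
    (hqN : q * N = s * m ^ 2) (hd : (1 - ε) * (p * ((1 - ε) / M)) * m ≤ d + 1)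
    (hone : 1 ≤ ε * (1 - ε) ^ 2 * (p * m / M)) (hE : E ≤ (1 + ε) * (p * N)) :
    (1 - 5 * ε) * E ≤ L * d * s * m := by
  have hN : 0 ≤ N := by
    have : 0 ≤ q * N := hqN ▸ by positivity
    exact nonneg_of_mul_nonneg_right this hq
  -- Rounding `d` down costs at most 1, which `hone` absorbs into a third factor `1 - ε`.
  have h1 : (1 - ε) ^ 3 * (p * m / M) ≤ d := by
    have e1 : (1 - ε) * (p * ((1 - ε) / M)) * m = (1 - ε) ^ 2 * (p * m / M) := by ring
    rw [e1] at hd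
    nlinarith
  have h2 : (1 - ε) ^ 3 * (p * N) ≤ (1 + ε) * (L * d * s * m) := by
    have e2 : (1 - ε) ^ 3 * (p * m) ≤ d * M := by
      rw [← mul_div_assoc, div_le_iff₀ hM] at h1
      exact h1
    have hd0 : 0 ≤ d := le_trans (by have : 0 ≤ 1 - ε := by linarith
                                     positivity) h1
    have e3 : d * M ≤ d * ((1 + ε) * (q * L)) := mul_le_mul_of_nonneg_left hML hd0
    have e4 : (1 - ε) ^ 3 * (p * m) * (s * m) ≤ d * ((1 + ε) * (q * L)) * (s * m) :=
      mul_le_mul_of_nonneg_right (e2.trans e3) (by positivity)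
    refine le_of_mul_le_mul_right ?_ hq
    calc (1 - ε) ^ 3 * (p * N) * q = (1 - ε) ^ 3 * p * (q * N) := by ring
      _ = (1 - ε) ^ 3 * (p * m) * (s * m) := by rw [hqN]; ring
      _ ≤ _ := e4
      _ = _ := by ring
  have h3 : (1 - 5 * ε) * E ≤ (1 - 5 * ε) * ((1 + ε) * (p * N)) :=
    mul_le_mul_of_nonneg_left hE (by linarith)
  -- The source of the constant 5: three losses `1 - ε` (assignment, random graph, rounding) and two
  -- excesses `1 + ε` (`M` and the edge count). The difference of the coefficients is `12ε² + 4ε³`.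
  have h4 : (1 - 5 * ε) * (1 + ε) ^ 2 * (p * N) ≤ (1 - ε) ^ 3 * (p * N) := by
    refine mul_le_mul_of_nonneg_right ?_ (by positivity)
    nlinarith [pow_pos hε 2, pow_pos hε 3]
  refine h3.trans (le_of_mul_le_mul_left ?_ (show 0 < 1 + ε by linarith))
  calc (1 + ε) * ((1 - 5 * ε) * ((1 + ε) * (p * N))) = (1 - 5 * ε) * (1 + ε) ^ 2 * (p * N) := by ring
    _ ≤ _ := h4.trans h2

end Parameters

/-! ### Choice of parameters and conclusion. -/

section Main

open SimpleGraph

variable {t m : ℕ} {V : Type*} [Fintype V] {T : SimpleGraph (Fin t)}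

set_option maxHeartbeats 1000000 in
/-- Quantitative form of the main theorem. -/
theorem binomialRandom_not_coverable_le (ht : 2 ≤ t) (hT : T.IsTree) (e₀ : Fin t × Fin m ≃ V)
    (p : unitInterval) {ε : ℝ} (hε : 0 < ε) (hε1 : ε < 1 / 5) (hn : 9 ≤ Fintype.card V)
    (hp : 10000 * (t : ℝ) ^ 2 * Real.log (Fintype.card V) ^ 2 ≤ ε ^ 4 * Fintype.card V * p) :
    (binomialRandom V p).real {G | ¬ CoverableByFactors T (5 * ε) G} ≤ 9 / Fintype.card V := by
  classical
  have hcard : Fintype.card V = t * m := by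
    rw [← Fintype.card_congr e₀]; simp
  set n : ℝ := ((Fintype.card V : ℕ) : ℝ) with hn_def
  set lam : ℝ := Real.log n with hlam
  -- The bound 9 ensures `log n ≥ 1`, `8 / n < 1` and `(n - 1) / 8 ≥ 1`.
  have hn9 : 9 ≤ n := by rw [hn_def]; exact_mod_cast hn
  have hntm : n = t * m := by rw [hn_def, hcard]; push_cast; rfl
  have ht2 : (2 : ℝ) ≤ t := by exact_mod_cast ht
  have hm1 : (1 : ℝ) ≤ m := by
    have : 1 ≤ m := by
      rcases Nat.eq_zero_or_pos m with h | h
      · rw [h] at hcard; omega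
      · exact h
    exact_mod_cast this
  have hlam1 : 1 ≤ lam := by
    rw [hlam, Real.le_log_iff_exp_le (by linarith)]
    linarith [Real.exp_one_lt_d9]
  have hp0 : (0 : ℝ) ≤ p := p.2.1
  have hp1 : (p : ℝ) ≤ 1 := p.2.2
  have h2m : 2 * (m : ℝ) ≤ n := by
    rw [hntm]; exact mul_le_mul_of_nonneg_right ht2 (by linarith)
  have htn : (t : ℝ) ≤ n := by
    rw [hntm]; exact le_mul_of_one_le_right (by linarith) hm1
  set s : ℝ := ((#(orderedEdges T) : ℕ) : ℝ) with hs_def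
  have hs : s + 1 = t := by rw [hs_def]; exact_mod_cast card_orderedEdges hT
  have hnn : 0 < n * (n - 1) := mul_pos (by linarith) (by linarith)
  obtain ⟨q, hq⟩ : ∃ q : ℝ, q * (n * (n - 1)) = 2 * s * m ^ 2 :=
    ⟨2 * s * m ^ 2 / (n * (n - 1)), div_mul_cancel₀ _ hnn.ne'⟩
  obtain ⟨hqt, hq1⟩ := crossing_probability_bounds ht2 hm1 hs (by rw [← hntm]; exact hq)
  have hq0 : 0 < q := lt_of_lt_of_le (by positivity) hqt
  have hε2 : 0 < ε ^ 2 := by positivity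
  have hε2' : ε ^ 2 ≤ 1 / 25 := by
    have := pow_le_pow_left₀ hε.le hε1.le 2
    linarith
  have hε4 : ε ^ 4 * n * p ≤ ε ^ 2 * n := by
    have h1 : ε ^ 4 * n * p ≤ ε ^ 4 * n := mul_le_of_le_one_right (by positivity) hp1
    have h2 : ε ^ 4 * n = ε ^ 2 * (ε ^ 2 * n) := by ring
    have h3 : ε ^ 2 * (ε ^ 2 * n) ≤ 1 * (ε ^ 2 * n) :=
      mul_le_mul_of_nonneg_right (by linarith) (by positivity)
    linarith
  -- Since `q ≥ 1 / t`, the Chernoff exponent `ε² q L / 4` is at least `4 log n`, which beats the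
  -- `n²` pairs.
  set L : ℕ := ⌈16 * t * lam / ε ^ 2⌉₊ with hL_def
  have hL1 : 16 * t * lam / ε ^ 2 ≤ L := Nat.le_ceil _
  have hbase : 1 ≤ t * lam / ε ^ 2 := by
    rw [le_div_iff₀ hε2]
    have : 1 ≤ t * lam := one_le_mul_of_one_le_of_one_le (by linarith) hlam1
    linarith
  have hL2 : (L : ℝ) ≤ 17 * (t * lam / ε ^ 2) := by
    have := (Nat.ceil_lt_add_one (show 0 ≤ 16 * t * lam / ε ^ 2 by positivity)).le
    have e : 16 * t * lam / ε ^ 2 = 16 * (t * lam / ε ^ 2) := by ring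
    linarith
  have hL0 : (0 : ℝ) < L := by
    have e : 16 * t * lam / ε ^ 2 = 16 * (t * lam / ε ^ 2) := by ring
    linarith
  have hqL : 16 * lam / ε ^ 2 ≤ q * L := by
    calc 16 * lam / ε ^ 2 = 1 / t * (16 * t * lam / ε ^ 2) := by field_simp
      _ ≤ q * L := by gcongr
  have hLn : (L : ℝ) ≤ n := by
    refine hL2.trans ?_
    rw [← mul_div_assoc, div_le_iff₀ hε2]
    have h1 : t * lam ≤ t ^ 2 * lam ^ 2 := by
      have : 1 ≤ t * lam := one_le_mul_of_one_le_of_one_le (by linarith) hlam1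
      rw [← mul_pow]
      exact le_self_pow₀ this two_ne_zero
    have h2 : 0 ≤ t * lam := by positivity
    linarith
  obtain ⟨e, he⟩ := exists_partitions (T := T) e₀ L (q := q) (δ := ε) hq hq0.le hε.le (by linarith)
    (by
      have h1 : Real.exp (-(ε ^ 2 * (q * L) / 4)) ≤ 1 / n ^ 4 := by
        refine exp_neg_le_inv_pow (by linarith) 4 ?_
        rw [div_le_iff₀ hε2] at hqL
        push_cast
        linarith
      have h2 : n ^ 2 * (1 / n ^ 4) = 1 / n ^ 2 := by field_simp
      calc n ^ 2 * Real.exp (-(ε ^ 2 * (q * L) / 4)) ≤ n ^ 2 * (1 / n ^ 4) := by gcongr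
        _ = 1 / n ^ 2 := h2
        _ < 1 := by rw [div_lt_one (by positivity)]; exact one_lt_pow₀ (by linarith) two_ne_zero)
  set M : ℕ := ⌊(1 + ε) * (q * L)⌋₊ with hM_def
  have hM1 : (M : ℝ) ≤ (1 + ε) * (q * L) := Nat.floor_le (by positivity)
  have hM0 : 0 < M := by
    rw [hM_def, Nat.floor_pos]
    have h1 : 1 ≤ 16 * lam / ε ^ 2 := by rw [le_div_iff₀ hε2]; linarith
    exact (h1.trans hqL).trans (le_mul_of_one_le_left (by positivity) (by linarith))
  have hM0' : (0 : ℝ) < M := by exact_mod_cast hM0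
  have hM2 : (M : ℝ) ≤ 34 * (t * lam / ε ^ 2) := by
    have h1 : q * L ≤ L := mul_le_of_le_one_left hL0.le hq1
    have h2 : (1 + ε) * (q * L) ≤ 2 * L := by gcongr; linarith
    linarith
  -- Here the assumption on `ε⁴ n p / log² n` is used: `M` is of order at most `t log n / ε²`, and
  -- the union bounds need a further `log n / ε²`. The constants give `200 * 34 = 6800 ≤ 10000`.
  have hkey : 200 * lam ≤ ε ^ 2 * (p * m / M) := by
    rw [← mul_div_assoc, le_div_iff₀ hM0']
    have h1 : 200 * lam * M ≤ 200 * lam * (34 * (t * lam / ε ^ 2)) := by gcongr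
    refine h1.trans ?_
    have h2 : 200 * lam * (34 * (t * lam / ε ^ 2)) = 6800 * t * lam ^ 2 / ε ^ 2 := by ring
    rw [h2, div_le_iff₀ hε2]
    have h3 : 6800 * t * lam ^ 2 * t ≤ ε ^ 2 * (p * m) * ε ^ 2 * t := by
      have e1 : ε ^ 2 * (p * m) * ε ^ 2 * t = ε ^ 4 * n * p := by rw [hntm]; ring
      rw [e1]
      refine le_trans ?_ hp
      have : 0 ≤ (t : ℝ) ^ 2 * lam ^ 2 := by positivity
      linarith
    exact le_of_mul_le_mul_right h3 (by linarith)
  have hpm : 0 ≤ (p : ℝ) * m / M := by positivity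
  -- An exponent of `4 log n` outweighs the factor `8 L t² m ≤ 8 n³`.
  have hr : ∀ A : ℝ, 4 * lam ≤ A → 2 * m * Real.exp (-A) ≤ 1 ∧
      L * t ^ 2 * (8 * m * Real.exp (-A)) ≤ 8 / n := by
    intro A hA
    have h1 : Real.exp (-A) ≤ 1 / n ^ 4 :=
      exp_neg_le_inv_pow (by linarith) 4 (by push_cast; exact hA)
    constructor
    · calc 2 * m * Real.exp (-A) ≤ n * (1 / n ^ 4) := by gcongr
        _ = 1 / n ^ 3 := by field_simp
        _ ≤ 1 := by
          rw [div_le_one (by positivity)]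
          exact one_le_pow₀ (by linarith)
    · calc L * t ^ 2 * (8 * m * Real.exp (-A)) = 8 * (L * t * (t * m) * Real.exp (-A)) := by ring
        _ ≤ 8 * (n * n * n * (1 / n ^ 4)) := by rw [← hntm]; gcongr
        _ = 8 / n := by field_simp
  have h8n : 8 / n < 1 := by rw [div_lt_one (by linarith)]; linarith
  have hA1 : 4 * lam ≤ ε ^ 2 * (1 / M) * 1 * m / 16 := by
    have h1 : (p : ℝ) * m / M ≤ 1 * m / M := by gcongr
    have h2 := mul_le_mul_of_nonneg_left h1 hε2.le
    have e1 : ε ^ 2 * (1 / M) * 1 * m / 16 = ε ^ 2 * (1 * m / M) / 16 := by ring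
    linarith
  obtain ⟨D, hD, hW⟩ := exists_assignment hM0 e (fun a => Nat.le_floor (he a)) hε.le
    (by linarith) (hr _ hA1).1 (lt_of_le_of_lt (hr _ hA1).2 h8n)
  have hA2 : 4 * lam ≤ ε ^ 2 * p * ((1 - ε) / M) * m / 16 := by
    have e1 : ε ^ 2 * p * ((1 - ε) / M) * m / 16 = (1 - ε) * (ε ^ 2 * (p * m / M)) / 16 := by ring
    have h1 : 4 / 5 * (ε ^ 2 * (p * m / M)) ≤ (1 - ε) * (ε ^ 2 * (p * m / M)) :=
      mul_le_mul_of_nonneg_right (by linarith) (by positivity)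
    rw [e1]
    linarith
  set d : ℕ := ⌊(1 - ε) * (p * ((1 - ε) / M)) * m⌋₊ with hd_def
  have hw0 : 0 ≤ (1 - ε) / M := div_nonneg (by linarith) hM0'.le
  have hd0 : 0 ≤ (1 - ε) * (p * ((1 - ε) / M)) * m :=
    mul_nonneg (mul_nonneg (by linarith) (mul_nonneg hp0 hw0)) (by linarith)
  have hstage := binomialRandom_no_factors_le hT p e hD hw0 hW hε.le (by linarith)
    (Nat.floor_le hd0) (hr _ hA2).1
  have hedges := binomialRandom_card_edgeSet_gt_le (V := V) p (N := n * (n - 1) / 2) (δ := ε)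
    (by rw [← hn_def]; ring) hε.le (by linarith)
  have hlast : Real.exp (-(ε ^ 2 * (p * (n * (n - 1) / 2)) / 4)) ≤ 1 / n := by
    have h1 := exp_neg_le_inv_pow (n := n) (A := ε ^ 2 * (p * (n * (n - 1) / 2)) / 4)
      (by linarith) 1 (by
        have e1 : ε ^ 4 * n * p ≤ ε ^ 2 * n * p := by
          have : ε ^ 4 * n * p = ε ^ 2 * (ε ^ 2 * n * p) := by ring
          rw [this]
          exact mul_le_of_le_one_left (by positivity) (by linarith)
        have e2 : 10000 * lam ≤ 10000 * (t : ℝ) ^ 2 * lam ^ 2 := by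
          have h1 : (1 : ℝ) ≤ (t : ℝ) ^ 2 := one_le_pow₀ (by linarith)
          have h2 : lam ≤ lam ^ 2 := le_self_pow₀ hlam1 two_ne_zero
          have h3 : 1 * lam ≤ (t : ℝ) ^ 2 * lam ^ 2 := mul_le_mul h1 h2 (by linarith) (by linarith)
          linarith
        have e3 : 0 ≤ ε ^ 2 * n * p := by positivity
        have e4 : ε ^ 2 * (p * (n * (n - 1) / 2)) / 4 = ε ^ 2 * n * p * ((n - 1) / 8) := by ring
        have e5 : ε ^ 2 * n * p * 1 ≤ ε ^ 2 * n * p * ((n - 1) / 8) :=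
          mul_le_mul_of_nonneg_left (by linarith) e3
        rw [e4, Nat.cast_one, one_mul]
        linarith)
    simpa using h1
  have hone : 1 ≤ ε * (1 - ε) ^ 2 * (p * m / M) := by
    have h1 : ε ^ 2 * (p * m / M) = ε * (ε * (p * m / M)) := by ring
    have h2 : 0 ≤ ε * (p * m / M) := by positivity
    have h3 : 200 ≤ ε * (p * m / M) := by
      have : ε * (ε * (p * m / M)) ≤ ε * (p * m / M) := mul_le_of_le_one_left h2 (by linarith)
      linarith
    have h4 : 1 / 4 ≤ (1 - ε) ^ 2 := by
      have := pow_le_pow_left₀ (show (0 : ℝ) ≤ 1 / 2 by norm_num)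
        (show 1 / 2 ≤ 1 - ε by linarith) 2
      linarith
    have h5 : 1 / 4 * (ε * (p * m / M)) ≤ (1 - ε) ^ 2 * (ε * (p * m / M)) :=
      mul_le_mul_of_nonneg_right h4 h2
    have e1 : ε * (1 - ε) ^ 2 * (p * m / M) = (1 - ε) ^ 2 * (ε * (p * m / M)) := by ring
    rw [e1]
    linarith
  calc _ ≤ (binomialRandom V p).real (_ ∪ _) := measureReal_mono ?_ (measure_ne_top _ _)
    _ ≤ _ := measureReal_union_le _ _
    _ ≤ 8 / n + 1 / n := add_le_add (hstage.trans (hr _ hA2).2) (hedges.trans hlast)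
    _ = 9 / n := by ring
  intro G hG
  by_contra hcon
  rw [Set.mem_union, not_or] at hcon
  obtain ⟨h1, h2⟩ := hcon
  obtain ⟨𝓕, hF, hFd, hFc⟩ := not_not.1 h1
  refine hG (coverableByFactors_of_le hF hFd ?_)
  have h3 : (L : ℝ) * d * s * m ≤ (⋃ F ∈ 𝓕, edgesOfFactor F).ncard := by
    rw [hs_def]; exact_mod_cast hFc
  refine le_trans ?_ h3
  exact one_sub_mul_le_covered hε hε1 hp0 (by linarith) hM0' hq0 (by linarith) hM1
    (by linarith) (Nat.lt_floor_add_one _).le hone (not_lt.1 h2)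

end Main

theorem theorem2 (t : ℕ) (ht : 2 ≤ t) (T : SimpleGraph (Fin t)) (hT : T.IsTree) :
    ∃ C : ℝ, 0 < C ∧
      ∀ (ε : ℕ → ℝ) (p : ℕ → unitInterval),
        (∀ n, 0 < ε n) →
        Tendsto (fun n : ℕ => ε n ^ 4 * (n : ℝ) * (p n : ℝ) / Real.log (n : ℝ) ^ 2)
          (multiplesAtTop t) atTop →
        Tendsto
          (fun n : ℕ => SimpleGraph.binomialRandom (Fin n) (p n)
            {G : SimpleGraph (Fin n) | CoverableByFactors T (C * ε n) G})
          (multiplesAtTop t) (𝓝 1) := by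
  refine ⟨5, by norm_num, fun ε p hε hlim => ?_⟩
  have hle : multiplesAtTop t ≤ atTop := inf_le_left
  have hlow : ∀ᶠ n : ℕ in multiplesAtTop t, ENNReal.ofReal (1 - 9 / (n : ℝ)) ≤
      SimpleGraph.binomialRandom (Fin n) (p n)
        {G : SimpleGraph (Fin n) | CoverableByFactors T (5 * ε n) G} := by
    have hdvd : ∀ᶠ n : ℕ in multiplesAtTop t, t ∣ n := by
      have : ∀ᶠ n : ℕ in 𝓟 {n : ℕ | t ∣ n}, t ∣ n := eventually_principal.2 fun _ h => h
      exact this.filter_mono inf_le_right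
    filter_upwards [hdvd, hlim.eventually_ge_atTop (10000 * (t : ℝ) ^ 2),
      hle (eventually_ge_atTop 9)] with n hdvd hn hn9
    have hn9' : (9 : ℝ) ≤ n := by exact_mod_cast hn9
    set A := {G : SimpleGraph (Fin n) | CoverableByFactors T (5 * ε n) G} with hA
    have hbad : (SimpleGraph.binomialRandom (Fin n) (p n)).real Aᶜ ≤ 9 / n := by
      -- For `ε n ≥ 1/5` the allowed fraction `5 ε n` is at least 1, and the empty collection works.
      by_cases hε1 : ε n < 1 / 5
      · obtain ⟨m, rfl⟩ := hdvd
        have hlog : 0 < Real.log ((t * m : ℕ) : ℝ) := Real.log_pos (by linarith)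
        have h := binomialRandom_not_coverable_le ht hT finProdFinEquiv (p (t * m)) (hε _) hε1
          (by simpa using hn9) (by
            rw [Fintype.card_fin]
            rwa [le_div_iff₀ (by positivity)] at hn)
        rw [Fintype.card_fin] at h
        exact h
      · have : Aᶜ = ∅ := by
          rw [Set.compl_empty_iff, Set.eq_univ_iff_forall]
          exact fun G => coverableByFactors_of_one_le (by linarith)
        rw [this, measureReal_empty]
        positivity
    rw [← ENNReal.ofReal_toReal (measure_ne_top _ A)]
    refine ENNReal.ofReal_le_ofReal ?_
    have h1 : (SimpleGraph.binomialRandom (Fin n) (p n)).real (A ∪ Aᶜ) = 1 := by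
      rw [Set.union_compl_self]; simp
    have h2 := measureReal_union_le (μ := SimpleGraph.binomialRandom (Fin n) (p n)) A Aᶜ
    rw [h1] at h2
    change _ ≤ (SimpleGraph.binomialRandom (Fin n) (p n)).real A
    linarith
  have htend : Tendsto (fun n : ℕ => ENNReal.ofReal (1 - 9 / (n : ℝ))) (multiplesAtTop t) (𝓝 1) := by
    have h1 : Tendsto (fun n : ℕ => (1 : ℝ) - 9 / (n : ℝ)) atTop (𝓝 (1 - 0)) :=
      tendsto_const_nhds.sub (tendsto_const_div_atTop_nhds_zero_nat 9)
    have h2 := (ENNReal.tendsto_ofReal h1).mono_left hle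
    simpa using h2
  exact tendsto_of_tendsto_of_tendsto_of_le_of_le' htend tendsto_const_nhds hlow
    (Eventually.of_forall fun n => prob_le_one)
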